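/- **Theorem B (Cartan–Hadamard theorem).** Let $X$ be a connected, nonempty simplicial complex (all simplices are finite) whose $1$-skeleton contains no infinite clique. Write $v\sim w$ if $v\ne w$ span an edge, let $d$ be the path metric on the vertices of the $1$-skeleton, and let $B_i(v,X)$ and $S_i(v,X)$ be the full subcomplexes of $X$ spanned by the vertices at distance at most $i$, respectively exactly $i$, from $v$. The link of a simplex $\sigma$ is $X_\sigma=\{\tau\in X:\tau\cap\sigma=\emptyset,\ \tau\cup\sigma\in X\}$. A complex is *flag* if every nonempty finite set of pairwise adjacent vertices is a simplex. A *$k$-wheel* $(v_0;v_1,\dots,v_k)$, $k\ge 4$, in a flag complex consists of a full (induced) $k$-cycle $(v_1,\dots,v_k)$ and a vertex $v_0$ adjacent to all $v_i$; a *$k$-wheel with a pendant triangle* $(v_0;v_1,\dots,v_k;t)$ is the union of a $k$-wheel and a triangle $\langle v_1,v_2,t\rangle\in X$ with $t\ne v_i$ for $i=0,\dots,k$. Suppose that $X$ satisfies $SD_2^{*}$, that is: * $X$ is flag; * (a) $X$ contains no $4$-wheel; * (b) every $5$-wheel with a pendant triangle in $X$ is contained in $B_1(v,X)$ for some vertex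 $v$. Then $X$ has a universal cover that is a simplicial complex with simplicial covering map, and every such universal cover (a simplicial map $f\colon Y\to X$ that induces a covering map of geometric realizations, with $Y$ simply connected) has the following properties: 1. $Y$ is *weakly systolic*: it is flag and for every vertex $v$ of $Y$ and every $i\ge 1$, (E) for every edge $e$ of $S_{i+1}(v,Y)$ the intersection $Y_e\cap B_i(v,Y)$ is nonempty, and (V) for every vertex $w$ of $S_{i+1}(v,Y)$ the intersection $Y_w\cap B_i(v,Y)$ is a single simplex (with its faces); 2. $Y$ is contractible (its geometric realization with the weak topology is a contractible space). -/

import Mathlib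

universe u w

noncomputable section

open Classical

namespace AbstractSimplicialComplex

variable {V : Type u} {W : Type w}

/-- The `1`-skeleton: distinct vertices `v`, `w` are joined when `{v, w}` is a simplex. Its
extended path distance `edist` is the combinatorial metric (`⊤` between different components). -/
def oneSkeleton (X : AbstractSimplicialComplex V) : SimpleGraph V where
  Adj v w := v ≠ w ∧ ({v, w} : Finset V) ∈ X.faces
  symm := ⟨fun v w h => ⟨h.1.symm, by rw [Finset.pair_comm]; exact h.2⟩⟩
  loopless := ⟨fun _ h => h.1 rfl⟩

/-- `X` is flag: every (nonempty) finite set of pairwise joined vertices is a simplex. -/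
def IsFlag (X : AbstractSimplicialComplex V) : Prop :=
  ∀ s : Finset V, s.Nonempty → X.oneSkeleton.IsClique (s : Set V) → s ∈ X.faces

/-- The full subcomplex spanned by a set of vertices. -/
def fullSubcomplex (X : AbstractSimplicialComplex V) (S : Set V) :
    PreAbstractSimplicialComplex V where
  faces := {s | s ∈ X.faces ∧ (s : Set V) ⊆ S}
  isRelLowerSet_faces := fun _ hs =>
    ⟨(X.isRelLowerSet_faces hs.1).1, fun _ hts ht =>
      ⟨(X.isRelLowerSet_faces hs.1).2 hts ht, (Finset.coe_subset.2 hts).trans hs.2⟩⟩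

/-- The combinatorial ball `B_i(v, X)`. -/
def ball (X : AbstractSimplicialComplex V) (v : V) (i : ℕ) : PreAbstractSimplicialComplex V :=
  X.fullSubcomplex {w | X.oneSkeleton.edist v w ≤ i}

/-- The combinatorial sphere `S_i(v, X)`. -/
def sphere (X : AbstractSimplicialComplex V) (v : V) (i : ℕ) : PreAbstractSimplicialComplex V :=
  X.fullSubcomplex {w | X.oneSkeleton.edist v w = i}

/-- The link `X_σ`. -/
def link (X : AbstractSimplicialComplex V) (σ : Finset V) : PreAbstractSimplicialComplex V where
  faces := {τ | τ ∈ X.faces ∧ Disjoint τ σ ∧ τ ∪ σ ∈ X.faces}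
  isRelLowerSet_faces := fun _ hτ =>
    ⟨(X.isRelLowerSet_faces hτ.1).1, fun _ hρτ hρ =>
      ⟨(X.isRelLowerSet_faces hτ.1).2 hρτ hρ, Finset.disjoint_of_subset_left hρτ hτ.2.1,
        (X.isRelLowerSet_faces hτ.2.2).2 (Finset.union_subset_union_left hρτ)
          (hρ.mono Finset.subset_union_left)⟩⟩

/-- The property `SD~_n(v)`: for `i = 1, …, n`, the edge condition (every edge of the sphere
`S_{i+1}(v)` has a nonempty intersection of its link with `B_i(v)`) and the vertex condition (for
every vertex of `S_{i+1}(v)` the intersection of its link with `B_i(v)` is a single simplex, that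
is, it consists of a simplex `τ` of `X` and all its faces). -/
def SatisfiesWeakSD (X : AbstractSimplicialComplex V) (n : ℕ) (v : V) : Prop :=
  ∀ i : ℕ, 1 ≤ i → i ≤ n →
    (∀ e ∈ (X.sphere v (i + 1)).faces, e.card = 2 →
      (X.link e ⊓ X.ball v i).faces.Nonempty) ∧
    (∀ w : V, {w} ∈ (X.sphere v (i + 1)).faces →
      ∃ τ ∈ X.faces, (X.link {w} ⊓ X.ball v i).faces = {ρ | ρ.Nonempty ∧ ρ ⊆ τ})

/-- Weakly systolic complexes. -/
def IsWeaklySystolic (X : AbstractSimplicialComplex V) : Prop :=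
  X.IsFlag ∧ ∀ (n : ℕ) (v : V), X.SatisfiesWeakSD n v

/-- `(c; r 0, …, r (k - 1))` is a `k`-wheel of a flag complex: the rim is a full (that is, induced)
`k`-cycle and the hub `c` is joined to all of its vertices. -/
def IsWheel (X : AbstractSimplicialComplex V) {k : ℕ} (c : V)
    (r : SimpleGraph.cycleGraph k ↪g X.oneSkeleton) : Prop :=
  ∀ i, X.oneSkeleton.Adj c (r i)

/-- The condition `SD_2^*`: `X` is flag, has no `4`-wheels, and every `5`-wheel
`(c; r 0, …, r 4)` with a pendant triangle `⟨r 0, r 1, t⟩` lies in the `1`-ball of some vertex. -/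
def SatisfiesSD2Star (X : AbstractSimplicialComplex V) : Prop :=
  X.IsFlag ∧
  (¬ ∃ (c : V) (r : SimpleGraph.cycleGraph 4 ↪g X.oneSkeleton), X.IsWheel c r) ∧
  (∀ (c : V) (r : SimpleGraph.cycleGraph 5 ↪g X.oneSkeleton) (t : V),
    X.IsWheel c r → ({r 0, r 1, t} : Finset V) ∈ X.faces → t ≠ c → (∀ i, t ≠ r i) →
    ∃ v : V, {c} ∈ (X.ball v 1).faces ∧ (∀ i, {r i} ∈ (X.ball v 1).faces) ∧
      {t} ∈ (X.ball v 1).faces)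

/-- The points of the geometric realization: barycentric coordinates supported on a simplex. -/
@[ext]
structure Realization (X : AbstractSimplicialComplex V) where
  /-- the barycentric coordinates -/
  coord : V →₀ ℝ
  support_mem : coord.support ∈ X.faces
  nonneg : ∀ v, 0 ≤ coord v
  sum_eq_one : coord.sum (fun _ a => a) = 1

/-- A finitely supported function with nonnegative values of sum `1`, supported in a simplex, is a
point of the realization. -/
def Realization.ofFace (X : AbstractSimplicialComplex V) (φ : V →₀ ℝ) (s : Finset V)
    (hs : s ∈ X.faces) (hφ : φ.support ⊆ s) (h0 : ∀ v, 0 ≤ φ v)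
    (h1 : φ.sum (fun _ a => a) = 1) : X.Realization where
  coord := φ
  support_mem := (X.isRelLowerSet_faces hs).2 hφ (by
    rw [Finsupp.support_nonempty_iff]; rintro rfl; simp at h1)
  nonneg := h0
  sum_eq_one := h1

/-- The inclusion of a closed geometric simplex in the realization. -/
def simplexInclusion (X : AbstractSimplicialComplex V) (s : X.faces)
    (x : stdSimplex ℝ (s : Finset V)) : X.Realization :=
  Realization.ofFace X
    (Finsupp.onFinset (s : Finset V) (fun v => if h : v ∈ (s : Finset V) then x.1 ⟨v, h⟩ else 0)
      (fun v hv => by by_contra h; simp [h] at hv))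
    s s.2 Finsupp.support_onFinset_subset
    (fun v => by
      rw [Finsupp.onFinset_apply]
      split_ifs with h
      · exact x.2.1 ⟨v, h⟩
      · exact le_rfl)
    (by
      rw [Finsupp.onFinset_sum _ (fun _ => rfl), ← x.2.2, ← Finset.sum_coe_sort]
      exact Finset.sum_congr rfl (fun v _ => by simp))

/-- The weak topology of the realization: a set is open when its preimage in every closed
geometric simplex is open. -/
instance (X : AbstractSimplicialComplex V) : TopologicalSpace X.Realization :=
  ⨆ s : X.faces, TopologicalSpace.coinduced (X.simplexInclusion s) inferInstance

/-- Simplicial maps. -/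
structure SimplicialMap (Y : AbstractSimplicialComplex W) (X : AbstractSimplicialComplex V) where
  /-- the map on vertices -/
  toFun : W → V
  map_faces : ∀ s ∈ Y.faces, s.image toFun ∈ X.faces

/-- The map induced on realizations, affine on every simplex. -/
def SimplicialMap.realize {Y : AbstractSimplicialComplex W} {X : AbstractSimplicialComplex V}
    (f : SimplicialMap Y X) (φ : Y.Realization) : X.Realization :=
  Realization.ofFace X (Finsupp.mapDomain f.toFun φ.coord) (φ.coord.support.image f.toFun)
    (f.map_faces _ φ.support_mem) Finsupp.mapDomain_support
    (fun v => by
      rw [Finsupp.mapDomain, Finsupp.sum_apply]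
      refine Finset.sum_nonneg (fun a _ => ?_)
      change 0 ≤ Finsupp.single (f.toFun a) (φ.coord a) v
      rw [Finsupp.single_apply]
      split_ifs
      · exact φ.nonneg a
      · exact le_rfl)
    (by
      rw [Finsupp.sum_mapDomain_index (fun _ => rfl) (fun _ _ _ => rfl)]
      exact φ.sum_eq_one)

/-- A universal cover of `X`: a simplicial map from a complex `Y` with simply connected (in
particular nonempty and path connected) realization, which is a covering map of realizations. -/
def IsUniversalCover {Y : AbstractSimplicialComplex W} {X : AbstractSimplicialComplex V}
    (f : SimplicialMap Y X) : Prop :=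
  IsCoveringMap f.realize ∧ SimplyConnectedSpace Y.Realization

end AbstractSimplicialComplex

end

/-! Everything reduces to the 1-skeleton. Triangle covers (graph maps that are isomorphisms on
closed neighbourhoods) between flag complexes realize to covering maps. Conversely, a simplicial
covering of a flag complex has flag source and is a triangle cover. Both wheel conditions pull back
along such maps. A level function `IsLevel` encodes the edge and vertex conditions about one base
point.

Construction (`exists_triangleCover`). A triangle cover with a level function is built ball by ball.
A vertex a of the outer sphere needs a new neighbour over each z not yet reached from it; the new
vertices are classes of pairs (a, z), with (a, z) and (b, z) identified when a and b are near. The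
crux is that this relation is transitive (`Stage.Valid.pending_near_trans`): a failure yields,
through the edge and vertex conditions inside the ball, a 4-wheel, or a 5-wheel with a pendant
triangle whose cone vertex contradicts the levels. As each class is a clique, the conditions pass to
the next sphere.

Contraction (`contractibleSpace_of_isLevel`). A simplex of a sphere has a common neighbour one level
lower, so the outer sphere can be pushed inwards. Without infinite cliques a vertex has finitely
many lower neighbours, so each closed simplex moves within finitely many vertices and continuity can
be read off from coordinates. Thus the constructed cover is contractible and is a universal cover.

Arbitrary universal covers. Y inherits all hypotheses, so the construction applies to Y itself, at
any vertex. Since Y is simply connected, the resulting cover of Y is bijective on vertices, and Y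
carries a level function about every vertex. It equals the distance; its axioms give (E) and (V),
and the contraction applies to Y. -/

noncomputable section

open Classical

/-! ### Triangle covers, wheel conditions and level functions -/

namespace SimpleGraph

variable {V : Type u} {W : Type w}

/-- Two vertices are near when they are equal or adjacent. -/
def Near (G : SimpleGraph V) (a b : V) : Prop := a = b ∨ G.Adj a b

theorem Near.symm {G : SimpleGraph V} {a b : V} (h : G.Near a b) : G.Near b a :=
  h.elim (fun h => Or.inl h.symm) (fun h => Or.inr h.symm)

/-- A map of graphs that is an isomorphism on closed neighbourhoods. -/
structure TriangleCover (H : SimpleGraph W) (G : SimpleGraph V) (p : W → V) : Prop where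
  hom : ∀ {a b}, H.Adj a b → G.Adj (p a) (p b)
  inj : ∀ {a b c}, H.Adj a b → H.Adj a c → p b = p c → b = c
  full : ∀ {a b c}, H.Adj a b → H.Adj a c → G.Adj (p b) (p c) → H.Adj b c
  surj : ∀ {a z}, G.Adj (p a) z → ∃ b, H.Adj a b ∧ p b = z

/-- No closed walk of length four in the neighbourhood of a vertex is an induced cycle. -/
def NoFourWheel (G : SimpleGraph V) : Prop :=
  ∀ c x₀ x₁ x₂ x₃, G.Adj c x₀ → G.Adj c x₁ → G.Adj c x₂ → G.Adj c x₃ →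
    G.Adj x₀ x₁ → G.Adj x₁ x₂ → G.Adj x₂ x₃ → G.Adj x₃ x₀ → G.Near x₀ x₂ ∨ G.Near x₁ x₃

/-- Every wheel with five spokes and a pendant triangle lies in the ball of radius one around
some vertex. -/
def FiveWheelCone (G : SimpleGraph V) : Prop :=
  ∀ c x₀ x₁ x₂ x₃ x₄ t, G.Adj c x₀ → G.Adj c x₁ → G.Adj c x₂ → G.Adj c x₃ → G.Adj c x₄ →
    G.Adj x₀ x₁ → G.Adj x₁ x₂ → G.Adj x₂ x₃ → G.Adj x₃ x₄ → G.Adj x₄ x₀ →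
    ¬ G.Near x₀ x₂ → ¬ G.Near x₀ x₃ → ¬ G.Near x₁ x₃ → ¬ G.Near x₁ x₄ → ¬ G.Near x₂ x₄ →
    G.Adj t x₀ → G.Adj t x₁ → t ≠ c → t ≠ x₂ → t ≠ x₃ → t ≠ x₄ →
    ∃ v, G.Near v c ∧ G.Near v x₀ ∧ G.Near v x₁ ∧ G.Near v x₂ ∧ G.Near v x₃ ∧ G.Near v x₄ ∧
      G.Near v t

/-- A level function behaving like the distance from `o` in a weakly systolic complex. -/
structure IsLevel (G : SimpleGraph V) (o : V) (l : V → ℕ) : Prop where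
  base : l o = 0
  zero : ∀ {a}, l a = 0 → a = o
  step : ∀ {a b}, G.Adj a b → l b ≤ l a + 1
  down : ∀ {a k}, l a = k + 1 → ∃ b, G.Adj a b ∧ l b = k
  low : ∀ {a b c k}, l a = k + 1 → G.Adj a b → G.Adj a c → l b = k → l c = k → G.Near b c
  edge : ∀ {a b k}, G.Adj a b → l a = k + 1 → l b = k + 1 →
    ∃ c, l c = k ∧ G.Adj a c ∧ G.Adj b c

theorem TriangleCover.near {H : SimpleGraph W} {G : SimpleGraph V} {p : W → V}
    (h : TriangleCover H G p) {a b c : W} (hb : H.Near a b) (hc : H.Near a c)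
    (hbc : G.Near (p b) (p c)) : H.Near b c := by
  rcases hb with rfl | hb
  · exact hc
  rcases hc with rfl | hc
  · exact Or.inr hb.symm
  exact hbc.imp (h.inj hb hc) (h.full hb hc)

theorem TriangleCover.near_map {H : SimpleGraph W} {G : SimpleGraph V} {p : W → V}
    (h : TriangleCover H G p) {a b : W} (hb : H.Near a b) : G.Near (p a) (p b) :=
  hb.imp (congrArg p) h.hom

theorem TriangleCover.near_surj {H : SimpleGraph W} {G : SimpleGraph V} {p : W → V}
    (h : TriangleCover H G p) {a : W} {z : V} (hz : G.Near (p a) z) : ∃ b, H.Near a b ∧ p b = z := by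
  rcases hz with rfl | hz
  · exact ⟨a, Or.inl rfl, rfl⟩
  · obtain ⟨b, hb, rfl⟩ := h.surj hz
    exact ⟨b, Or.inr hb, rfl⟩

theorem TriangleCover.noFourWheel {H : SimpleGraph W} {G : SimpleGraph V} {p : W → V}
    (h : TriangleCover H G p) (hG : G.NoFourWheel) : H.NoFourWheel := by
  intro c x₀ x₁ x₂ x₃ h0 h1 h2 h3 h01 h12 h23 h30
  exact (hG _ _ _ _ _ (h.hom h0) (h.hom h1) (h.hom h2) (h.hom h3) (h.hom h01) (h.hom h12)
    (h.hom h23) (h.hom h30)).imp (h.near (Or.inr h0) (Or.inr h2)) (h.near (Or.inr h1) (Or.inr h3))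

/-- The wheel projects to a genuine wheel because all its vertices neighbour the hub. The cone
vertex is lifted next to the hub. Its nearness to `t`, which need not neighbour the hub, is lifted
through `x₀`, which neighbours `t`. -/
theorem TriangleCover.fiveWheelCone {H : SimpleGraph W} {G : SimpleGraph V} {p : W → V}
    (h : TriangleCover H G p) (hG : G.FiveWheelCone) : H.FiveWheelCone := by
  intro c x₀ x₁ x₂ x₃ x₄ t h0 h1 h2 h3 h4 h01 h12 h23 h34 h40 n02 n03 n13 n14 n24 ht0 ht1 htc ht2
    ht3 ht4
  have far : ∀ {x y}, H.Adj c x → H.Adj c y → ¬ H.Near x y → ¬ G.Near (p x) (p y) :=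
    fun hx hy hn hxy => hn (h.near (Or.inr hx) (Or.inr hy) hxy)
  obtain ⟨v, vc, v0, v1, v2, v3, v4, vt⟩ := hG (p c) (p x₀) (p x₁) (p x₂) (p x₃) (p x₄) (p t)
    (h.hom h0) (h.hom h1) (h.hom h2) (h.hom h3) (h.hom h4) (h.hom h01) (h.hom h12) (h.hom h23)
    (h.hom h34) (h.hom h40) (far h0 h2 n02) (far h0 h3 n03) (far h1 h3 n13) (far h1 h4 n14)
    (far h2 h4 n24) (h.hom ht0) (h.hom ht1) (fun e => htc (h.inj ht0.symm h0.symm e))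
    (fun e => ht2 (h.inj ht1.symm h12 e))
    (fun e => far h0 h3 n03 (Or.inr (e ▸ (h.hom ht0).symm)))
    (fun e => ht4 (h.inj ht0.symm h40.symm e))
  obtain ⟨v, hv, rfl⟩ := h.near_surj vc.symm
  have hv0 := h.near hv (Or.inr h0) v0
  exact ⟨v, hv.symm, hv0, h.near hv (Or.inr h1) v1, h.near hv (Or.inr h2) v2,
    h.near hv (Or.inr h3) v3, h.near hv (Or.inr h4) v4,
    h.near hv0.symm (Or.inr ht0.symm) vt⟩

/-! ### Balls of the universal cover and the identification of new vertices -/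

/-- The data of a partially built cover: its vertices are edge paths, read backwards and without
the base point, and the length of a path is its level. -/
structure Stage (V : Type u) where
  /-- the vertices -/
  verts : Set (List V)
  /-- the edges -/
  graph : SimpleGraph (List V)

/-- A stage is a ball of radius `n` in the universal cover of `G` based at `o`. -/
structure Stage.Valid (G : SimpleGraph V) (o : V) (S : Stage V) (n : ℕ) : Prop where
  nil_mem : [] ∈ S.verts
  mem : ∀ {a b}, S.graph.Adj a b → a ∈ S.verts
  len : ∀ {a}, a ∈ S.verts → a.length ≤ n
  hom : ∀ {a b}, S.graph.Adj a b → G.Adj (a.headD o) (b.headD o)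
  inj : ∀ {a b c}, S.graph.Adj a b → S.graph.Adj a c → b.headD o = c.headD o → b = c
  full : ∀ {a b c}, S.graph.Adj a b → S.graph.Adj a c → G.Adj (b.headD o) (c.headD o) →
    S.graph.Adj b c
  -- Only interior vertices have a full neighbourhood; what is missing on the outer sphere is
  -- recorded by `Pending`.
  surj : ∀ {a z}, a ∈ S.verts → a.length < n → G.Adj (a.headD o) z →
    ∃ b, S.graph.Adj a b ∧ b.headD o = z
  step : ∀ {a b}, S.graph.Adj a b → b.length ≤ a.length + 1
  down : ∀ {a k}, a ∈ S.verts → a.length = k + 1 → ∃ b, S.graph.Adj a b ∧ b.length = k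
  low : ∀ {a b c k}, a.length = k + 1 → S.graph.Adj a b → S.graph.Adj a c → b.length = k →
    c.length = k → S.graph.Near b c
  edge : ∀ {a b k}, S.graph.Adj a b → a.length = k + 1 → b.length = k + 1 →
    ∃ c, c.length = k ∧ S.graph.Adj a c ∧ S.graph.Adj b c

namespace Stage

variable (G : SimpleGraph V) (o : V) (S : Stage V) (n : ℕ)

/-- `z` is a neighbour of the endpoint of `a` that is not yet covered by a neighbour of `a`. -/
def Pending (a : List V) (z : V) : Prop :=
  a ∈ S.verts ∧ a.length = n ∧ G.Adj (a.headD o) z ∧ ∀ u, S.graph.Adj a u → u.headD o ≠ z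

/-- The new vertex over `z` next to `a`. -/
def fresh (a : List V) (z : V) : List V :=
  z :: Classical.epsilon fun b => Pending G o S n b z ∧ S.graph.Near b a

/-- The adjacency of the next stage. -/
def nextAdj (a b : List V) : Prop :=
  S.graph.Adj a b ∨ (Pending G o S n a (b.headD o) ∧ b = fresh G o S n a (b.headD o)) ∨
    (Pending G o S n b (a.headD o) ∧ a = fresh G o S n b (a.headD o)) ∨
    ∃ c, Pending G o S n c (a.headD o) ∧ Pending G o S n c (b.headD o) ∧
      G.Adj (a.headD o) (b.headD o) ∧ a = fresh G o S n c (a.headD o) ∧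
      b = fresh G o S n c (b.headD o)

/-- The next stage. -/
def next : Stage V where
  verts := S.verts ∪ {a | ∃ c, Pending G o S n c (a.headD o) ∧ a = fresh G o S n c (a.headD o)}
  graph :=
    { Adj := fun a b => nextAdj G o S n a b
      symm := ⟨fun a b h => by
        rcases h with h | h | h | ⟨c, h1, h2, h3, h4, h5⟩
        · exact Or.inl h.symm
        · exact Or.inr (Or.inr (Or.inl h))
        · exact Or.inr (Or.inl h)
        · exact Or.inr (Or.inr (Or.inr ⟨c, h2, h1, h3.symm, h5, h4⟩))⟩
      loopless := ⟨fun a h => by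
        rcases h with h | h | h | ⟨c, h1, h2, h3, h4, h5⟩
        · exact S.graph.loopless.irrefl _ h
        · exact G.loopless.irrefl _ h.1.2.2.1
        · exact G.loopless.irrefl _ h.1.2.2.1
        · exact G.loopless.irrefl _ h3⟩ }

variable {G o S n}

theorem Valid.eq_nil {a : List V} (h : a.length = 0) : a = [] := List.length_eq_zero_iff.1 h

/-- An interior `u` already has all its neighbours. A neighbour of `u` over `z` would by `full` be a
neighbour of `a` over `z`, which a pending pair excludes. -/
theorem Valid.far_of_lower (hS : Valid G o S n) {a u : List V} {z : V}
    (ha : Pending G o S n a z) (hu : S.graph.Adj a u) (hl : u.length < n) :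
    ¬ G.Near (u.headD o) z := by
  rintro (h | h)
  · exact ha.2.2.2 u hu h
  · obtain ⟨b, hb, rfl⟩ := hS.surj (hS.mem hu.symm) hl h
    exact ha.2.2.2 b (hS.full hu.symm hb ha.2.2.1) rfl

/-- If `a` and `c` were far, take common lower neighbours `u` of `a`, `b` and `u'` of `b`, `c`. If
`u` or `u'` serves all three, the hub `b` and the rim `a, u, c, z` form a 4-wheel. Otherwise the hub
`b` and the rim `u, u', c, z, a`, with a vertex `t` below `u, u'`, form a 5-wheel with a pendant
triangle. -/
theorem Valid.pending_near_trans (hS : Valid G o S n) (h4 : G.NoFourWheel) (h5 : G.FiveWheelCone)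
    {a b c : List V} {z : V} (ha : Pending G o S n a z) (hb : Pending G o S n b z)
    (hc : Pending G o S n c z) (hab : S.graph.Near a b) (hbc : S.graph.Near b c) :
    S.graph.Near a c := by
  rcases hab with rfl | hab
  · exact hbc
  rcases hbc with rfl | hbc
  · exact Or.inr hab
  by_contra hac
  -- far in the cover implies far in the base, for neighbours of a common vertex
  have far : ∀ {e x y}, S.graph.Adj e x → S.graph.Adj e y → ¬ S.graph.Near x y →
      ¬ G.Near (x.headD o) (y.headD o) :=
    fun hx hy hn hxy => hn (hxy.imp (hS.inj hx hy) (hS.full hx hy))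
  obtain ⟨k, rfl⟩ : ∃ k, n = k + 1 := by
    -- Level 0 contains only the base point, so it has no edge.
    refine Nat.exists_eq_succ_of_ne_zero ?_
    rintro rfl
    rw [Valid.eq_nil ha.2.1, Valid.eq_nil hb.2.1] at hab
    exact S.graph.loopless.irrefl _ hab
  have hG := far hab.symm hbc hac
  -- a common lower neighbour of all three yields a wheel with four spokes
  have key : ∀ u, u.length = k → S.graph.Adj u a → S.graph.Adj u b → S.graph.Adj u c → False := by
    intro u hu hua hub huc
    rcases h4 (b.headD o) (a.headD o) (u.headD o) (c.headD o) z (hS.hom hab.symm)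
      (hS.hom hub.symm) (hS.hom hbc) hb.2.2.1 (hS.hom hua.symm) (hS.hom huc) hc.2.2.1
      ha.2.2.1.symm with h | h
    · exact hG h
    · exact hS.far_of_lower ha hua.symm (by omega) h
  obtain ⟨u, hu, hau, hbu⟩ := hS.edge hab ha.2.1 hb.2.1
  obtain ⟨u', hu', hbu', hcu'⟩ := hS.edge hbc hb.2.1 hc.2.1
  rcases hS.low hb.2.1 hbu hbu' hu hu' with rfl | huu'
  · exact key u hu hau.symm hbu.symm hcu'.symm
  have huc : ¬ S.graph.Near u c := by
    rintro (rfl | h)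
    · have := hc.2.1; omega
    · exact key u hu hau.symm hbu.symm h
  have hu'a : ¬ S.graph.Near u' a := by
    rintro (rfl | h)
    · have := ha.2.1; omega
    · exact key u' hu' h hbu'.symm hcu'.symm
  obtain ⟨m, rfl⟩ : ∃ m, k = m + 1 := by
    refine Nat.exists_eq_succ_of_ne_zero ?_
    rintro rfl
    rw [Valid.eq_nil hu, Valid.eq_nil hu'] at huu'
    exact S.graph.loopless.irrefl _ huu'
  obtain ⟨t, ht, hut, hu't⟩ := hS.edge huu' hu hu'
  have hta : ¬ S.graph.Near t a := by
    rintro (rfl | h)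
    · have := ha.2.1; omega
    · have := hS.step h; have := ha.2.1; omega
  have htc : ¬ S.graph.Near t c := by
    rintro (rfl | h)
    · have := hc.2.1; omega
    · have := hS.step h; have := hc.2.1; omega
  have htb : ¬ S.graph.Near t b := by
    rintro (rfl | h)
    · have := hb.2.1; omega
    · have := hS.step h; have := hb.2.1; omega
  obtain ⟨v, -, v0, -, -, v3, v4, vt⟩ := h5 (b.headD o) (u.headD o) (u'.headD o) (c.headD o) z
    (a.headD o) (t.headD o) (hS.hom hbu) (hS.hom hbu') (hS.hom hbc) hb.2.2.1 (hS.hom hab.symm)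
    (hS.hom huu') (hS.hom hcu'.symm) hc.2.2.1 ha.2.2.1.symm (hS.hom hau)
    (far hbu hbc huc) (hS.far_of_lower ha hau (by omega)) (hS.far_of_lower hc hcu' (by omega))
    (far hbu' hab.symm hu'a) (fun h => hG h.symm)
    (hS.hom hut.symm) (hS.hom hu't.symm)
    (fun e => far hut hbu.symm htb (Or.inl e)) (fun e => far hu't hcu'.symm htc (Or.inl e))
    (fun e => hS.far_of_lower ha hau (by omega) (Or.inr (e ▸ hS.hom hut)))
    (fun e => far hut hau.symm hta (Or.inl e))
  rcases v0 with rfl | v0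
  · exact hS.far_of_lower ha hau (by omega) v3
  -- The cone vertex lifts next to the interior vertex `u`. Nearness to `t` keeps its level below
  -- that of `a`; being near `a`, it is then a lower neighbour of `a` and must be far from `z`,
  -- although it is near `z`.
  obtain ⟨v, hv, rfl⟩ := hS.surj (hS.mem hut) (by omega) v0.symm
  have hvt : v.length ≤ t.length + 1 := by
    rcases vt.imp (hS.inj hv hut) (hS.full hv hut) with rfl | h
    · omega
    · exact hS.step h.symm
  rcases v4.imp (hS.inj hv hau.symm) (hS.full hv hau.symm) with rfl | h
  · have := ha.2.1; omega
  · exact hS.far_of_lower ha h.symm (by omega) v3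

theorem Pending.spec {a : List V} {z : V} (ha : Pending G o S n a z) :
    ∃ r, fresh G o S n a z = z :: r ∧ Pending G o S n r z ∧ S.graph.Near r a :=
  ⟨_, rfl, Classical.epsilon_spec
    (p := fun b => Pending G o S n b z ∧ S.graph.Near b a) ⟨a, ha, Or.inl rfl⟩⟩

theorem Pending.length_fresh {a : List V} {z : V} (ha : Pending G o S n a z) :
    (fresh G o S n a z).length = n + 1 := by
  obtain ⟨r, hr, h, -⟩ := ha.spec
  rw [hr, List.length_cons, h.2.1]

/-- By transitivity the predicates defining the two classes coincide, and `epsilon` then chooses the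
same representative. -/
theorem Valid.fresh_eq (hS : Valid G o S n) (h4 : G.NoFourWheel) (h5 : G.FiveWheelCone)
    {a b : List V} {z : V} (ha : Pending G o S n a z) (hb : Pending G o S n b z)
    (hab : S.graph.Near a b) : fresh G o S n a z = fresh G o S n b z := by
  unfold fresh
  congr 2
  funext c
  refine propext (and_congr_right fun hc => ⟨fun h => ?_, fun h => ?_⟩)
  · exact hS.pending_near_trans h4 h5 hc ha hb h hab
  · exact hS.pending_near_trans h4 h5 hc hb ha h hab.symm

/-- Equal lists have the same tail, which is a pending vertex near both `a` and `b`. -/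
theorem Valid.near_of_fresh_eq (hS : Valid G o S n) (h4 : G.NoFourWheel) (h5 : G.FiveWheelCone)
    {a b : List V} {z : V} (ha : Pending G o S n a z) (hb : Pending G o S n b z)
    (hab : fresh G o S n a z = fresh G o S n b z) : S.graph.Near a b := by
  obtain ⟨r, hr, h, hra⟩ := ha.spec
  obtain ⟨r', hr', h', hrb⟩ := hb.spec
  rw [hr, hr'] at hab
  obtain rfl : r = r' := (List.cons.inj hab).2
  exact hS.pending_near_trans h4 h5 ha h hb hra.symm hrb

end Stage

end SimpleGraph
-- Passage to the next ball and the union of all balls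
namespace SimpleGraph

variable {V : Type u} {W : Type w}

namespace Stage

variable {G : SimpleGraph V} {o : V} {S : Stage V} {n : ℕ}

/-- Length separates old vertices from new ones, which all have length `n + 1`. -/
theorem adj_of_le {a b : List V} (ha : a.length ≤ n)
    (h : (next G o S n).graph.Adj a b) :
    S.graph.Adj a b ∨ (Pending G o S n a (b.headD o) ∧ b = fresh G o S n a (b.headD o)) := by
  rcases h with h | h | h | ⟨c, h1, h2, h3, h4, h5⟩
  · exact Or.inl h
  · exact Or.inr h
  · have := h.1.length_fresh
    rw [← h.2] at this
    omega
  · have := h1.length_fresh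
    rw [← h4] at this
    omega

theorem Valid.adj_of_eq (hS : Valid G o S n) {a b : List V} (ha : a.length = n + 1)
    (h : (next G o S n).graph.Adj a b) :
    (Pending G o S n b (a.headD o) ∧ a = fresh G o S n b (a.headD o)) ∨
    ∃ c, Pending G o S n c (a.headD o) ∧ Pending G o S n c (b.headD o) ∧
      G.Adj (a.headD o) (b.headD o) ∧ a = fresh G o S n c (a.headD o) ∧
      b = fresh G o S n c (b.headD o) := by
  rcases h with h | h | h | h
  · have := hS.len (hS.mem h)
    omega
  · have := h.1.2.1
    omega
  · exact Or.inl h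
  · exact Or.inr h

theorem adj_fresh {a : List V} {z : V} (ha : Pending G o S n a z) :
    (next G o S n).graph.Adj a (fresh G o S n a z) :=
  Or.inr (Or.inl ⟨ha, rfl⟩)

theorem adj_fresh_fresh {a : List V} {z z' : V} (ha : Pending G o S n a z)
    (ha' : Pending G o S n a z') (hz : G.Adj z z') :
    (next G o S n).graph.Adj (fresh G o S n a z) (fresh G o S n a z') :=
  Or.inr (Or.inr (Or.inr ⟨a, ha, ha', hz, rfl, rfl⟩))

/-- For a new `a`, the old vertices witnessing the two edges lie in one class, hence are near. Two
old neighbours over one point cannot be adjacent, an old and a new one would contradict pendency,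
and two new ones form the same class. -/
theorem Valid.next_inj (hS : Valid G o S n) (h4 : G.NoFourWheel) (h5 : G.FiveWheelCone)
    {a b c : List V} (hla : a.length ≤ n + 1) (hab : (next G o S n).graph.Adj a b)
    (hac : (next G o S n).graph.Adj a c) (hbc : b.headD o = c.headD o) : b = c := by
  rcases Nat.lt_or_ge n a.length with hlt | hle
  · have hl : a.length = n + 1 := by omega
    rcases hS.adj_of_eq hl hab with ⟨hb, eb⟩ | ⟨b', hb, hb', zb, eb, eb'⟩ <;>
    rcases hS.adj_of_eq hl hac with ⟨hc, ec⟩ | ⟨c', hc, hc', zc, ec, ec'⟩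
    · refine (hS.near_of_fresh_eq h4 h5 hb hc (eb.symm.trans ec)).resolve_right fun h => ?_
      exact (hS.hom h).ne hbc
    · exfalso
      rcases hS.near_of_fresh_eq h4 h5 hb hc (eb.symm.trans ec) with rfl | h
      · exact hc'.2.2.1.ne hbc
      · exact hc'.2.2.2 b h.symm hbc
    · exfalso
      rcases hS.near_of_fresh_eq h4 h5 hc hb (ec.symm.trans eb) with rfl | h
      · exact hb'.2.2.1.ne hbc.symm
      · exact hb'.2.2.2 c h.symm hbc.symm
    · rw [eb', ec', hbc]
      rw [hbc] at hb'
      exact hS.fresh_eq h4 h5 hb' hc' (hS.near_of_fresh_eq h4 h5 hb hc (eb.symm.trans ec))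
  · rcases adj_of_le hle hab with hb | ⟨hb, eb⟩ <;>
    rcases adj_of_le hle hac with hc | ⟨hc, ec⟩
    · exact hS.inj hb hc hbc
    · exact absurd hbc (hc.2.2.2 b hb)
    · exact absurd hbc.symm (hb.2.2.2 c hc)
    · rw [eb, ec, hbc]

theorem Valid.next_full_of_le (hS : Valid G o S n) (h4 : G.NoFourWheel) (h5 : G.FiveWheelCone)
    {a b c : List V} (hla : a.length ≤ n) (hab : (next G o S n).graph.Adj a b)
    (hac : (next G o S n).graph.Adj a c) (hbc : G.Adj (b.headD o) (c.headD o)) :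
    (next G o S n).graph.Adj b c := by
  -- By `far_of_lower` an old neighbour `b` is itself on the outer sphere and pending over the same
  -- point, so `c` is also its new neighbour.
  have mixed : ∀ {b c}, S.graph.Adj a b → Pending G o S n a (c.headD o) →
      c = fresh G o S n a (c.headD o) → G.Adj (b.headD o) (c.headD o) →
      (next G o S n).graph.Adj b c := by
    intro b c hb hc ec hbc
    have hlb : b.length = n := by
      by_contra hne
      have := hS.len (hS.mem hb.symm)
      exact hS.far_of_lower hc hb (by omega) (Or.inr hbc)
    have hbp : Pending G o S n b (c.headD o) :=
      ⟨hS.mem hb.symm, hlb, hbc, fun u hu e =>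
        hc.2.2.2 u (hS.full hb.symm hu (e ▸ hc.2.2.1)) e⟩
    rw [ec, hS.fresh_eq h4 h5 hc hbp (Or.inr hb)]
    exact adj_fresh hbp
  rcases adj_of_le hla hab with hb | ⟨hb, eb⟩ <;>
  rcases adj_of_le hla hac with hc | ⟨hc, ec⟩
  · exact Or.inl (hS.full hb hc hbc)
  · exact mixed hb hc ec hbc
  · exact (mixed hc hb eb hbc.symm).symm
  · rw [eb, ec]
    exact adj_fresh_fresh hb hc hbc

theorem Valid.next_full (hS : Valid G o S n) (h4 : G.NoFourWheel) (h5 : G.FiveWheelCone)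
    {a b c : List V} (hla : a.length ≤ n + 1) (hab : (next G o S n).graph.Adj a b)
    (hac : (next G o S n).graph.Adj a c) (hbc : G.Adj (b.headD o) (c.headD o)) :
    (next G o S n).graph.Adj b c := by
  rcases Nat.lt_or_ge n a.length with hlt | hle
  swap
  · exact hS.next_full_of_le h4 h5 hle hab hac hbc
  have hl : a.length = n + 1 := by omega
  have mixed : ∀ {b c c'}, Pending G o S n b (a.headD o) → a = fresh G o S n b (a.headD o) →
      Pending G o S n c' (a.headD o) → Pending G o S n c' (c.headD o) →
      a = fresh G o S n c' (a.headD o) → c = fresh G o S n c' (c.headD o) →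
      G.Adj (b.headD o) (c.headD o) → (next G o S n).graph.Adj b c := by
    intro b c c' hb eb hc hc' ec ec' hbc
    have hcc' : (next G o S n).graph.Adj c' c := by rw [ec']; exact adj_fresh hc'
    rcases hS.near_of_fresh_eq h4 h5 hb hc (eb.symm.trans ec) with rfl | h
    · exact hcc'
    · exact hS.next_full_of_le h4 h5 hc.2.1.le (Or.inl h.symm) hcc' hbc
  rcases hS.adj_of_eq hl hab with ⟨hb, eb⟩ | ⟨b', hb, hb', zb, eb, eb'⟩ <;>
  rcases hS.adj_of_eq hl hac with ⟨hc, ec⟩ | ⟨c', hc, hc', zc, ec, ec'⟩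
  · refine Or.inl ((hS.near_of_fresh_eq h4 h5 hb hc (eb.symm.trans ec)).resolve_left ?_)
    rintro rfl
    exact hbc.ne rfl
  · exact mixed hb eb hc hc' ec ec' hbc
  · exact (mixed hc ec hb hb' eb eb' hbc.symm).symm
  · have hbb : (next G o S n).graph.Adj b' b := by rw [eb']; exact adj_fresh hb'
    have hcc : (next G o S n).graph.Adj c' c := by rw [ec']; exact adj_fresh hc'
    rcases hS.near_of_fresh_eq h4 h5 hb hc (eb.symm.trans ec) with rfl | h
    · exact hS.next_full_of_le h4 h5 hb.2.1.le hbb hcc hbc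
    -- The witnesses `b'`, `c'` and the new vertices `c`, `b` project to a closed 4-walk around `a`.
    -- A diagonal cannot collapse, by pendency; if it is an edge, `mixed` lifts it and splits the
    -- square into triangles based at an old vertex.
    rcases h4 (a.headD o) (b'.headD o) (c'.headD o) (c.headD o) (b.headD o)
      hb.2.2.1.symm hc.2.2.1.symm zc zb (hS.hom h) hc'.2.2.1 hbc.symm hb'.2.2.1.symm with
      (e | e) | (e | e)
    · exact absurd e (hc'.2.2.2 b' h.symm)
    · exact hS.next_full_of_le h4 h5 hb.2.1.le hbb (mixed hb eb hc hc' ec ec' e) hbc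
    · exact absurd e (hb'.2.2.2 c' h)
    · exact (hS.next_full_of_le h4 h5 hc.2.1.le hcc (mixed hc ec hb hb' eb eb' e) hbc.symm).symm

theorem Valid.next_len (hS : Valid G o S n) {a : List V} (ha : a ∈ (next G o S n).verts) :
    a.length ≤ n + 1 := by
  rcases ha with ha | ⟨c, hc, e⟩
  · exact (hS.len ha).trans (Nat.le_succ n)
  · rw [e, hc.length_fresh]

theorem Valid.next_mem (hS : Valid G o S n) {a b : List V}
    (h : (next G o S n).graph.Adj a b) : a ∈ (next G o S n).verts := by
  rcases h with h | h | h | ⟨c, h1, h2, h3, h4, h5⟩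
  · exact Or.inl (hS.mem h)
  · exact Or.inl h.1.1
  · exact Or.inr ⟨_, h⟩
  · exact Or.inr ⟨c, h1, h4⟩

theorem mem_of_le {a : List V} (ha : a ∈ (next G o S n).verts)
    (hl : a.length ≤ n) : a ∈ S.verts := by
  rcases ha with ha | ⟨c, hc, e⟩
  · exact ha
  · have := hc.length_fresh
    rw [← e] at this
    omega

theorem Valid.next (hS : Valid G o S n) (h4 : G.NoFourWheel) (h5 : G.FiveWheelCone) :
    Valid G o (Stage.next G o S n) (n + 1) where
  nil_mem := Or.inl hS.nil_mem
  mem := hS.next_mem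
  len := hS.next_len
  hom := by
    intro a b h
    rcases h with h | h | h | ⟨c, h1, h2, h3, h4, h5⟩
    · exact hS.hom h
    · exact h.1.2.2.1
    · exact h.1.2.2.1.symm
    · exact h3
  inj := fun hab hac => hS.next_inj h4 h5 (hS.next_len (hS.next_mem hab)) hab hac
  full := fun hab hac => hS.next_full h4 h5 (hS.next_len (hS.next_mem hab)) hab hac
  surj := by
    intro a z ha hl hz
    have ha' := mem_of_le ha (Nat.lt_succ_iff.1 hl)
    rcases Nat.lt_or_ge a.length n with hlt | hge
    · obtain ⟨b, hb, hbz⟩ := hS.surj ha' hlt hz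
      exact ⟨b, Or.inl hb, hbz⟩
    · by_cases hex : ∃ b, S.graph.Adj a b ∧ b.headD o = z
      · obtain ⟨b, hb, hbz⟩ := hex
        exact ⟨b, Or.inl hb, hbz⟩
      · push Not at hex
        exact ⟨_, adj_fresh (z := z) ⟨ha', by omega, hz, hex⟩, rfl⟩
  step := by
    intro a b h
    rcases h with h | h | h | ⟨c, h1, h2, h3, h4, h5⟩
    · exact hS.step h
    · rw [h.2, h.1.length_fresh, h.1.2.1]
    · rw [h.2, h.1.length_fresh, h.1.2.1]
      omega
    · rw [h4, h5, h1.length_fresh, h2.length_fresh]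
      omega
  down := by
    intro a k ha hk
    rcases ha with ha | ⟨c, hc, e⟩
    · obtain ⟨b, hb, hl⟩ := hS.down ha hk
      exact ⟨b, Or.inl hb, hl⟩
    · have hl := hc.length_fresh
      rw [← e] at hl
      refine ⟨c, Or.inr (Or.inr (Or.inl ⟨hc, e⟩)), ?_⟩
      have := hc.2.1
      omega
  low := by
    intro a b c k ha hab hac hb hc
    have old : ∀ {x y}, x.length ≤ n → y.length ≤ n → (Stage.next G o S n).graph.Adj x y →
        S.graph.Adj x y := by
      intro x y hx hy hxy
      refine (adj_of_le hx hxy).resolve_right fun h => ?_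
      have := h.1.length_fresh
      rw [← h.2] at this
      omega
    have hla := hS.next_len (hS.next_mem hab)
    rcases Nat.lt_or_ge n a.length with hlt | hle
    · have hl : a.length = n + 1 := by omega
      have low : ∀ {x}, x.length = k → (Stage.next G o S n).graph.Adj a x →
          Pending G o S n x (a.headD o) ∧ a = fresh G o S n x (a.headD o) := by
        intro x hx hax
        refine (hS.adj_of_eq hl hax).resolve_right ?_
        rintro ⟨c, h1, h2, -, -, e⟩
        have := h2.length_fresh
        rw [← e] at this
        omega
      obtain ⟨h1, e1⟩ := low hb hab
      obtain ⟨h2, e2⟩ := low hc hac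
      -- The lower neighbours of a new vertex are the members of its class.
      exact (hS.near_of_fresh_eq h4 h5 h1 h2 (e1.symm.trans e2)).imp_right Or.inl
    · exact (hS.low ha (old hle (by omega) hab) (old hle (by omega) hac) hb hc).imp_right Or.inl
  edge := by
    intro a b k hab ha hb
    have hla := hS.next_len (hS.next_mem hab)
    rcases Nat.lt_or_ge n a.length with hlt | hle
    · rcases hS.adj_of_eq (by omega) hab with ⟨h, e⟩ | ⟨c, h1, h2, -, e1, e2⟩
      · have := h.2.1
        omega
      -- Two new vertices are joined only through a common pending vertex, which lies one level
      -- lower.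
      · refine ⟨c, ?_, ?_, ?_⟩
        · have := h1.2.1
          omega
        · rw [e1]
          exact (adj_fresh h1).symm
        · rw [e2]
          exact (adj_fresh h2).symm
    · rcases adj_of_le hle hab with h | ⟨h, e⟩
      · obtain ⟨c, hc, h1, h2⟩ := hS.edge h ha hb
        exact ⟨c, hc, Or.inl h1, Or.inl h2⟩
      · have := h.length_fresh
        rw [← e] at this
        omega

variable (G o)

/-- The sequence of stages. -/
def seq : ℕ → Stage V
  | 0 => ⟨{[]}, ⊥⟩
  | n + 1 => next G o (seq n) n

theorem valid_seq (h4 : G.NoFourWheel) (h5 : G.FiveWheelCone) :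
    ∀ n, Valid G o (seq G o n) n
  | 0 =>
    { nil_mem := rfl
      mem := fun h => h.elim
      len := fun h => by rw [Set.mem_singleton_iff.1 h]; exact le_rfl
      hom := fun h => h.elim
      inj := fun h => h.elim
      full := fun h => h.elim
      surj := fun _ h => absurd h (Nat.not_lt_zero _)
      step := fun h => h.elim
      down := fun h hk => by rw [Set.mem_singleton_iff.1 h] at hk; simp at hk
      low := fun _ h => h.elim
      edge := fun h => h.elim }
  | n + 1 => (valid_seq h4 h5 n).next h4 h5

theorem seq_adj_mono {m n : ℕ} (h : m ≤ n) {a b : List V} (hab : (seq G o m).graph.Adj a b) :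
    (seq G o n).graph.Adj a b := by
  induction h with
  | refl => exact hab
  | step _ ih => exact Or.inl ih

theorem seq_verts_mono {m n : ℕ} (h : m ≤ n) {a : List V} (ha : a ∈ (seq G o m).verts) :
    a ∈ (seq G o n).verts := by
  induction h with
  | refl => exact ha
  | step _ ih => exact Or.inl ih

end Stage

open Stage in
/-- Every graph without four-wheels whose five-wheels with pendant triangle are coned off has a
triangle cover with a level function based at a prescribed vertex. -/
theorem exists_triangleCover (G : SimpleGraph V) (h4 : G.NoFourWheel) (h5 : G.FiveWheelCone)
    (o : V) : ∃ (W : Type u) (H : SimpleGraph W) (p : W → V) (o' : W) (l : W → ℕ),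
      p o' = o ∧ TriangleCover H G p ∧ IsLevel H o' l := by
  have hv := valid_seq G o h4 h5
  let D : Set (List V) := {a | ∃ n, a ∈ (seq G o n).verts}
  let K : SimpleGraph (List V) :=
    { Adj := fun a b => ∃ n, (seq G o n).graph.Adj a b
      symm := ⟨fun a b ⟨n, h⟩ => ⟨n, h.symm⟩⟩
      loopless := ⟨fun a ⟨n, h⟩ => (seq G o n).graph.loopless.irrefl _ h⟩ }
  have two : ∀ {a b c d : List V}, K.Adj a b → K.Adj c d →
      ∃ n, (seq G o n).graph.Adj a b ∧ (seq G o n).graph.Adj c d := by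
    rintro a b c d ⟨m, h⟩ ⟨n, h'⟩
    exact ⟨max m n, seq_adj_mono G o (le_max_left _ _) h, seq_adj_mono G o (le_max_right _ _) h'⟩
  have memD : ∀ {n : ℕ} {a b : List V}, (seq G o n).graph.Adj a b → b ∈ D :=
    fun {n _ _} h => ⟨n, (hv n).mem h.symm⟩
  refine ⟨D, K.comap Subtype.val, fun a => a.1.headD o, ⟨[], 0, (hv 0).nil_mem⟩,
    fun a => a.1.length, rfl, ⟨?_, ?_, ?_, ?_⟩, ⟨rfl, ?_, ?_, ?_, ?_, ?_⟩⟩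
  · rintro a b ⟨n, h⟩
    exact (hv n).hom h
  · intro a b c hab hac hbc
    obtain ⟨n, h, h'⟩ := two hab hac
    exact Subtype.ext ((hv n).inj h h' hbc)
  · intro a b c hab hac hbc
    obtain ⟨n, h, h'⟩ := two hab hac
    exact ⟨n, (hv n).full h h' hbc⟩
  · rintro ⟨a, m, ha⟩ z hz
    -- A stage in which `a` is interior.
    let n := max m (a.length + 1)
    obtain ⟨b, hb, hbz⟩ := (hv n).surj (seq_verts_mono G o (le_max_left _ _) ha)
      (Nat.lt_of_lt_of_le (Nat.lt_succ_self _) (le_max_right m (a.length + 1))) hz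
    exact ⟨⟨b, memD hb⟩, ⟨n, hb⟩, hbz⟩
  · intro a ha
    exact Subtype.ext (List.length_eq_zero_iff.1 ha)
  · rintro a b ⟨n, h⟩
    exact (hv n).step h
  · rintro ⟨a, m, ha⟩ k hk
    obtain ⟨b, hb, hl⟩ := (hv m).down ha hk
    exact ⟨⟨b, memD hb⟩, ⟨m, hb⟩, hl⟩
  · intro a b c k ha hab hac hb hc
    obtain ⟨n, h, h'⟩ := two hab hac
    exact ((hv n).low ha h h' hb hc).imp (fun e => Subtype.ext e) (fun e => ⟨n, e⟩)
  · rintro a b k ⟨n, h⟩ ha hb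
    obtain ⟨c, hc, h1, h2⟩ := (hv n).edge h ha hb
    exact ⟨⟨c, memD h1⟩, hc, ⟨n, h1⟩, ⟨n, h2⟩⟩

end SimpleGraph
-- Points and weak topology of the realization
namespace AbstractSimplicialComplex

variable {V : Type u} {W : Type w}

namespace Realization

variable {X : AbstractSimplicialComplex V}

theorem ext_coord {x y : X.Realization} (h : ∀ v, x.coord v = y.coord v) : x = y :=
  Realization.ext (Finsupp.ext h)

theorem sum_eq_of_support_subset (x : X.Realization) {s : Finset V} (hs : x.coord.support ⊆ s) :
    ∑ v ∈ s, x.coord v = 1 := by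
  rw [← x.sum_eq_one, Finsupp.sum_of_support_subset _ hs _ (fun _ _ => rfl)]

theorem mem_support_iff (x : X.Realization) {v : V} : v ∈ x.coord.support ↔ 0 < x.coord v := by
  rw [Finsupp.mem_support_iff]
  exact ⟨fun h => lt_of_le_of_ne (x.nonneg v) (Ne.symm h), fun h => h.ne'⟩

/-- The point with given barycentric coordinates on a face. -/
def ofCoords (s : Finset V) (hs : s ∈ X.faces) (φ : V → ℝ) (h : ∀ v, 0 ≤ φ v)
    (hφ : ∀ v, v ∉ s → φ v = 0) (h1 : ∑ v ∈ s, φ v = 1) : X.Realization :=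
  ofFace X (Finsupp.onFinset s φ fun v hv => by_contra fun h => hv (hφ v h)) s hs
    Finsupp.support_onFinset_subset h (by
      rw [Finsupp.onFinset_sum _ (fun _ => rfl), h1])

/-- The point of the realization given by a vertex. -/
def vertex (X : AbstractSimplicialComplex V) (v : V) : X.Realization :=
  ofCoords {v} (X.singleton_mem v) (fun u => if u = v then 1 else 0)
    (fun u => by split_ifs <;> norm_num) (fun u hu => if_neg fun h => hu (by simp [h])) (by simp)

theorem vertex_coord (v u : V) : (vertex X v).coord u = if u = v then 1 else 0 := rfl

theorem support_vertex (v : V) : (vertex X v).coord.support = {v} := by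
  ext u
  rw [Finsupp.mem_support_iff, vertex_coord, Finset.mem_singleton]
  split_ifs with h <;> simp [h]

/-- The barycenter of a face. -/
def barycenter (s : Finset V) (hs : s ∈ X.faces) : X.Realization :=
  ofCoords s hs (fun u => if u ∈ s then (s.card : ℝ)⁻¹ else 0)
    (fun u => by split_ifs <;> positivity) (fun u hu => if_neg hu) (by
      have h : (s.card : ℝ) ≠ 0 := by
        exact_mod_cast (Finset.card_pos.2 (X.isRelLowerSet_faces hs).1).ne'
      rw [Finset.sum_congr rfl (fun u hu => if_pos hu), Finset.sum_const, nsmul_eq_mul,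
        mul_inv_cancel₀ h])

theorem barycenter_coord (s : Finset V) (hs : s ∈ X.faces) (u : V) :
    (barycenter s hs).coord u = if u ∈ s then (s.card : ℝ)⁻¹ else 0 := rfl

theorem support_barycenter (s : Finset V) (hs : s ∈ X.faces) :
    (barycenter s hs).coord.support = s := by
  have h : (s.card : ℝ) ≠ 0 := by
    exact_mod_cast (Finset.card_pos.2 (X.isRelLowerSet_faces hs).1).ne'
  ext u
  rw [Finsupp.mem_support_iff, barycenter_coord]
  split_ifs with hu <;> simp [hu, h]

end Realization

open Realization

variable (X : AbstractSimplicialComplex V)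

theorem simplexInclusion_coord (s : X.faces) (x : stdSimplex ℝ (s : Finset V)) (v : V) :
    (X.simplexInclusion s x).coord v = if h : v ∈ (s : Finset V) then x.1 ⟨v, h⟩ else 0 := rfl

theorem support_simplexInclusion_subset (s : X.faces) (x : stdSimplex ℝ (s : Finset V)) :
    (X.simplexInclusion s x).coord.support ⊆ s := by
  intro v hv
  by_contra h
  rw [Finsupp.mem_support_iff, simplexInclusion_coord, dif_neg h] at hv
  exact hv rfl

theorem exists_simplexInclusion_eq (s : X.faces) {x : X.Realization}
    (hx : x.coord.support ⊆ s) : ∃ y, X.simplexInclusion s y = x := by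
  refine ⟨⟨fun v => x.coord v, fun v => x.nonneg v, ?_⟩, ext_coord fun v => ?_⟩
  · rw [Finset.sum_coe_sort (s : Finset V) (fun v => x.coord v)]
    exact x.sum_eq_of_support_subset hx
  · rw [simplexInclusion_coord]
    split_ifs with h
    · rfl
    · exact (Finsupp.notMem_support_iff.1 fun h' => h (hx h')).symm

theorem continuous_simplexInclusion (s : X.faces) : Continuous (X.simplexInclusion s) :=
  continuous_iff_coinduced_le.2 (le_iSup (fun s : X.faces =>
    TopologicalSpace.coinduced (X.simplexInclusion s) inferInstance) s)

variable {X}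

theorem isOpen_realization_iff {U : Set X.Realization} :
    IsOpen U ↔ ∀ s : X.faces, IsOpen (X.simplexInclusion s ⁻¹' U) := by
  rw [isOpen_iSup_iff]
  exact Iff.rfl

theorem continuous_realization_iff {Z : Type*} [TopologicalSpace Z] {g : X.Realization → Z} :
    Continuous g ↔ ∀ s : X.faces, Continuous (g ∘ X.simplexInclusion s) := by
  refine ⟨fun h s => h.comp (X.continuous_simplexInclusion s), fun h => ?_⟩
  exact ⟨fun U hU => isOpen_realization_iff.2 fun s => hU.preimage (h s)⟩

theorem continuous_coord (v : V) : Continuous fun x : X.Realization => x.coord v := by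
  refine continuous_realization_iff.2 fun s => ?_
  by_cases h : v ∈ (s : Finset V)
  · have : (fun x : X.Realization => x.coord v) ∘ X.simplexInclusion s =
        fun x => x.1 ⟨v, h⟩ := by
      funext x
      simp only [Function.comp_apply, simplexInclusion_coord, dif_pos h]
    rw [this]
    exact (continuous_apply _).comp continuous_subtype_val
  · have : (fun x : X.Realization => x.coord v) ∘ X.simplexInclusion s = fun x => 0 := by
      funext x
      simp only [Function.comp_apply, simplexInclusion_coord, dif_neg h]
    rw [this]
    exact continuous_const

/-- A map to the realization is continuous if its coordinates are and its image meets only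
finitely many vertices. -/
theorem continuous_of_coord {Z : Type*} [TopologicalSpace Z] {g : Z → X.Realization}
    (F : Finset V) (hF : ∀ z, (g z).coord.support ⊆ F)
    (hg : ∀ v ∈ F, Continuous fun z => (g z).coord v) : Continuous g := by
  let I := {s : Finset V // s ∈ F.powerset ∧ s ∈ X.faces}
  have : Finite I := (F.powerset.finite_toSet.subset fun s (hs : s ∈ F.powerset ∧ _) => hs.1)
  -- These finitely many closed sets cover `Z`, and on each of them `g` factors through one closed
  -- simplex.
  let C : I → Set Z := fun s => {z | (g z).coord.support ⊆ s.1}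
  have hC : ∀ s, IsClosed (C s) := by
    intro s
    have : C s = ⋂ v ∈ F \ s.1, {z | (g z).coord v = 0} := by
      ext z
      simp only [C, Set.mem_ofPred_eq, Set.mem_iInter, Finset.mem_sdiff]
      constructor
      · intro h v hv
        exact Finsupp.notMem_support_iff.1 fun h' => hv.2 (h h')
      · intro h v hv
        by_contra hvs
        exact (Finsupp.mem_support_iff.1 hv) (h v ⟨hF z hv, hvs⟩)
    rw [this]
    refine isClosed_biInter fun v hv => ?_
    exact isClosed_eq (hg v (Finset.mem_sdiff.1 hv).1) continuous_const
  have hcov : ⋃ s, C s = Set.univ := by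
    rw [Set.eq_univ_iff_forall]
    intro z
    exact Set.mem_iUnion.2 ⟨⟨(g z).coord.support, Finset.mem_powerset.2 (hF z),
      (g z).support_mem⟩, Finset.Subset.refl _⟩
  refine (locallyFinite_of_finite C).continuous hcov hC fun s => ?_
  rw [continuousOn_iff_continuous_domRestrict]
  let φ : C s → stdSimplex ℝ s.1 := fun z => ⟨fun v => (g z).coord v, fun v => (g z).nonneg v, by
    rw [Finset.sum_coe_sort s.1 (fun v => (g z.1).coord v)]
    exact (g z).sum_eq_of_support_subset z.2⟩
  have hφ : Continuous φ := by
    refine Continuous.subtype_mk (continuous_pi fun v => ?_) _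
    exact (hg v (Finset.mem_powerset.1 s.2.1 v.2)).comp continuous_subtype_val
  convert (X.continuous_simplexInclusion ⟨s.1, s.2.2⟩).comp hφ using 1
  funext z
  refine ext_coord fun v => ?_
  change (g z).coord v = _
  rw [Function.comp_apply, simplexInclusion_coord]
  split_ifs with h
  · rfl
  · exact Finsupp.notMem_support_iff.1 fun h' => h (z.2 h')

/-- The straight segment between two points of a closed simplex. -/
def segment (s : Finset V) (hs : s ∈ X.faces) (x y : X.Realization) (hx : x.coord.support ⊆ s)
    (hy : y.coord.support ⊆ s) (t : unitInterval) : X.Realization :=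
  ofCoords s hs (fun v => (1 - t) * x.coord v + t * y.coord v)
    (fun v => add_nonneg (mul_nonneg (sub_nonneg.2 t.2.2) (x.nonneg v))
      (mul_nonneg t.2.1 (y.nonneg v)))
    (fun v hv => by
      rw [Finsupp.notMem_support_iff.1 fun h => hv (hx h),
        Finsupp.notMem_support_iff.1 fun h => hv (hy h), mul_zero, mul_zero, add_zero])
    (by
      rw [Finset.sum_add_distrib, ← Finset.mul_sum, ← Finset.mul_sum,
        x.sum_eq_of_support_subset hx, y.sum_eq_of_support_subset hy]
      ring)

section segment

variable {s : Finset V} (hs : s ∈ X.faces) {x y : X.Realization} (hx : x.coord.support ⊆ s)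
    (hy : y.coord.support ⊆ s)

theorem segment_coord (t : unitInterval) (v : V) :
    (segment s hs x y hx hy t).coord v = (1 - t) * x.coord v + t * y.coord v := rfl

theorem segment_zero : segment s hs x y hx hy 0 = x :=
  ext_coord fun v => by rw [segment_coord]; simp

theorem segment_one : segment s hs x y hx hy 1 = y :=
  ext_coord fun v => by rw [segment_coord]; simp

theorem continuous_segment : Continuous (segment s hs x y hx hy) := by
  refine continuous_of_coord s (fun t v hv => ?_) fun v _ => ?_
  · by_contra h
    rw [Finsupp.mem_support_iff, segment_coord,
      Finsupp.notMem_support_iff.1 fun h' => h (hx h'),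
      Finsupp.notMem_support_iff.1 fun h' => h (hy h')] at hv
    simp at hv
  · simp only [segment_coord]
    fun_prop

end segment

theorem adj_of_mem_face {s : Finset V} (hs : s ∈ X.faces) {a b : V} (ha : a ∈ s) (hb : b ∈ s)
    (hab : a ≠ b) : X.oneSkeleton.Adj a b :=
  ⟨hab, (X.isRelLowerSet_faces hs).2 (Finset.insert_subset ha (Finset.singleton_subset_iff.2 hb))
    ⟨a, by simp⟩⟩

theorem near_of_mem_face {s : Finset V} (hs : s ∈ X.faces) {a b : V} (ha : a ∈ s) (hb : b ∈ s) :
    X.oneSkeleton.Near a b :=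
  or_iff_not_imp_left.2 fun h => adj_of_mem_face hs ha hb h

theorem IsFlag.mem_of_near (hX : X.IsFlag) {s : Finset V} (hs : s.Nonempty)
    (h : ∀ a ∈ s, ∀ b ∈ s, X.oneSkeleton.Near a b) : s ∈ X.faces :=
  hX s hs fun a ha b hb hab => (h a ha b hb).resolve_left hab

/-! ### Simplicial maps on realizations; triangle covers give covering maps -/

variable {Y : AbstractSimplicialComplex W} (f : SimplicialMap Y X)

theorem realize_coord (φ : Y.Realization) {s : Finset W} (hs : φ.coord.support ⊆ s) (v : V) :
    (f.realize φ).coord v = ∑ a ∈ s, if f.toFun a = v then φ.coord a else 0 := by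
  change Finsupp.mapDomain f.toFun φ.coord v = _
  rw [Finsupp.mapDomain, Finsupp.sum_apply,
    Finsupp.sum_of_support_subset _ hs _ (fun a _ => by simp)]
  exact Finset.sum_congr rfl fun a _ => Finsupp.single_apply

theorem support_realize (φ : Y.Realization) :
    (f.realize φ).coord.support = φ.coord.support.image f.toFun := by
  ext v
  rw [Realization.mem_support_iff, realize_coord f φ subset_rfl, Finset.mem_image]
  have h0 : ∀ a ∈ φ.coord.support, 0 ≤ if f.toFun a = v then φ.coord a else 0 := by
    intro a _
    split_ifs
    · exact φ.nonneg a
    · exact le_rfl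
  constructor
  · intro h
    obtain ⟨a, ha, h'⟩ := Finset.exists_ne_zero_of_sum_ne_zero h.ne'
    exact ⟨a, ha, by_contra fun hne => h' (if_neg hne)⟩
  · rintro ⟨a, ha, rfl⟩
    exact Finset.sum_pos' h0 ⟨a, ha, by rw [if_pos rfl]; exact φ.mem_support_iff.1 ha⟩

theorem realize_coord_apply (φ : Y.Realization) {s : Finset W} (hs : φ.coord.support ⊆ s)
    (hinj : Set.InjOn f.toFun s) {a : W} (ha : a ∈ s) :
    (f.realize φ).coord (f.toFun a) = φ.coord a := by
  rw [realize_coord f φ hs, Finset.sum_eq_single a, if_pos rfl]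
  · exact fun b hb hba => if_neg fun h => hba (hinj hb ha h)
  · exact fun h => absurd ha h

theorem continuous_realize : Continuous f.realize := by
  refine continuous_realization_iff.2 fun s => ?_
  refine continuous_of_coord ((s : Finset W).image f.toFun) (fun x => ?_) fun v _ => ?_
  · rw [Function.comp_apply, support_realize]
    exact Finset.image_subset_image (Y.support_simplexInclusion_subset s x)
  · have : (fun x => ((f.realize ∘ Y.simplexInclusion s) x).coord v) = fun x =>
        ∑ a ∈ (s : Finset W), if f.toFun a = v then (Y.simplexInclusion s x).coord a else 0 := by
      funext x
      exact realize_coord f _ (Y.support_simplexInclusion_subset s x) v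
    rw [this]
    refine continuous_finsetSum _ fun a _ => ?_
    split_ifs
    · exact (continuous_coord a).comp (Y.continuous_simplexInclusion s)
    · exact continuous_const

/-- The open star of a vertex. -/
def openStar (X : AbstractSimplicialComplex V) (v : V) : Set X.Realization := {x | 0 < x.coord v}

theorem isOpen_openStar (v : V) : IsOpen (X.openStar v) :=
  isOpen_lt continuous_const (continuous_coord v)

section cover

variable {f} (hf : Y.oneSkeleton.TriangleCover X.oneSkeleton f.toFun)
include hf

theorem injOn_of_mem_face {s : Finset W} (hs : s ∈ Y.faces) : Set.InjOn f.toFun s := by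
  intro a ha b hb hab
  by_contra hne
  exact (hf.hom (adj_of_mem_face hs ha hb hne)).ne hab

/-- The vertices of `s` lift one by one next to `a`; the lifts are pairwise near since their images
are, so flagness makes them a simplex. -/
theorem exists_lift_face (hY : Y.IsFlag) {s : Finset V} (hs : s ∈ X.faces) {a : W}
    (ha : f.toFun a ∈ s) : ∃ t ∈ Y.faces, a ∈ t ∧ t.image f.toFun = s := by
  have h : ∀ v : s, ∃ b, Y.oneSkeleton.Near a b ∧ f.toFun b = v := fun v =>
    hf.near_surj (near_of_mem_face hs ha v.2)
  choose g hg hgf using h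
  have hga : g ⟨f.toFun a, ha⟩ = a := by
    rcases hg ⟨f.toFun a, ha⟩ with h | h
    · exact h.symm
    · exact absurd (hgf ⟨f.toFun a, ha⟩).symm (hf.hom h).ne
  refine ⟨s.attach.image g, hY.mem_of_near ⟨a, ?_⟩ ?_, ?_, ?_⟩
  · exact Finset.mem_image.2 ⟨_, Finset.mem_attach _ _, hga⟩
  · intro b hb c hc
    obtain ⟨v, -, rfl⟩ := Finset.mem_image.1 hb
    obtain ⟨v', -, rfl⟩ := Finset.mem_image.1 hc
    refine hf.near (hg v) (hg v') ?_
    rw [hgf, hgf]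
    exact near_of_mem_face hs v.2 v'.2
  · exact Finset.mem_image.2 ⟨_, Finset.mem_attach _ _, hga⟩
  · ext v
    simp only [Finset.mem_image, Finset.mem_attach, true_and]
    constructor
    · rintro ⟨_, ⟨v', rfl⟩, rfl⟩
      rw [hgf]
      exact v'.2
    · intro hv
      exact ⟨_, ⟨⟨v, hv⟩, rfl⟩, hgf _⟩

/-- These continuous sections over closed simplices are what tests openness downstairs and gives
surjectivity of each sheet. -/
theorem exists_lift_simplex (hY : Y.IsFlag) (s : X.faces) {a : W}
    (ha : f.toFun a ∈ (s : Finset V)) :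
    ∃ h : stdSimplex ℝ (s : Finset V) → Y.Realization, Continuous h ∧
      (∀ x, f.realize (h x) = X.simplexInclusion s x) ∧
      ∀ x, (h x).coord a = (X.simplexInclusion s x).coord (f.toFun a) := by
  obtain ⟨t, ht, hat, hts⟩ := exists_lift_face hf hY s.2 ha
  have hinj := injOn_of_mem_face hf ht
  let h : stdSimplex ℝ (s : Finset V) → Y.Realization := fun x =>
    ofCoords t ht (fun b => if b ∈ t then (X.simplexInclusion s x).coord (f.toFun b) else 0)
      (fun b => by
        split_ifs
        · exact Realization.nonneg _ _
        · exact le_rfl)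
      (fun b hb => if_neg hb) (by
        rw [Finset.sum_congr rfl fun b hb => if_pos hb,
          ← Finset.sum_image (f := fun v => (X.simplexInclusion s x).coord v) hinj, hts]
        exact sum_eq_of_support_subset _ (X.support_simplexInclusion_subset s x))
  have hc : ∀ x b, (h x).coord b =
      if b ∈ t then (X.simplexInclusion s x).coord (f.toFun b) else 0 := fun x b => rfl
  have hsupp : ∀ x, (h x).coord.support ⊆ t := by
    intro x b hb
    by_contra hbt
    rw [Finsupp.mem_support_iff, hc, if_neg hbt] at hb
    exact hb rfl
  refine ⟨h, continuous_of_coord t hsupp fun b hb => ?_, fun x => ext_coord fun v => ?_,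
    fun x => by rw [hc, if_pos hat]⟩
  · simp only [hc, if_pos hb]
    exact (continuous_coord _).comp (X.continuous_simplexInclusion s)
  · by_cases hv : v ∈ (s : Finset V)
    · rw [← hts] at hv
      obtain ⟨b, hb, rfl⟩ := Finset.mem_image.1 hv
      rw [realize_coord_apply f _ (hsupp x) hinj hb, hc, if_pos hb]
    · rw [Finsupp.notMem_support_iff.1 fun h' => hv (X.support_simplexInclusion_subset s x h'),
        Finsupp.notMem_support_iff.1 fun h' => hv ?_]
      rw [support_realize] at h'
      rw [← hts]
      exact Finset.image_subset_image (hsupp x) h'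

theorem injOn_realize_openStar (a : W) : (Y.openStar a).InjOn f.realize := by
  intro φ hφ ψ hψ e
  have hsub : ∀ {φ ψ : Y.Realization}, φ ∈ Y.openStar a → ψ ∈ Y.openStar a →
      f.realize φ = f.realize ψ → φ.coord.support ⊆ ψ.coord.support := by
    intro φ ψ hφ hψ e b hb
    have h1 : f.toFun b ∈ (f.realize ψ).coord.support := by
      rw [← e, support_realize]
      exact Finset.mem_image_of_mem _ hb
    rw [support_realize] at h1
    obtain ⟨c, hc, hcb⟩ := Finset.mem_image.1 h1
    have h2 := near_of_mem_face φ.support_mem (φ.mem_support_iff.2 hφ) hb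
    have h3 := near_of_mem_face ψ.support_mem (ψ.mem_support_iff.2 hψ) hc
    have h4 := hf.near h3 h2 (Or.inl hcb)
    rcases h4 with rfl | h4
    · exact hc
    · exact absurd hcb (hf.hom h4).ne
  have hs : φ.coord.support = ψ.coord.support :=
    (hsub hφ hψ e).antisymm (hsub hψ hφ e.symm)
  refine ext_coord fun b => ?_
  by_cases hb : b ∈ φ.coord.support
  · rw [← realize_coord_apply f φ subset_rfl (injOn_of_mem_face hf φ.support_mem) hb, e,
      realize_coord_apply f ψ subset_rfl (injOn_of_mem_face hf ψ.support_mem) (hs ▸ hb)]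
  · rw [Finsupp.notMem_support_iff.1 hb, Finsupp.notMem_support_iff.1 (hs ▸ hb)]

/-- A simplicial map of flag complexes that is an isomorphism on closed neighbourhoods of the
`1`-skeleta induces a covering map of realizations. -/
theorem isCoveringMap_realize (hY : Y.IsFlag) : IsCoveringMap f.realize := by
  intro x
  obtain ⟨v, hv⟩ := (X.isRelLowerSet_faces x.support_mem).1
  have hxv : x ∈ X.openStar v := x.mem_support_iff.1 hv
  let ι := {a : W // f.toFun a = v}
  let _ : TopologicalSpace ι := ⊥
  have : DiscreteTopology ι := ⟨rfl⟩
  have hmem : ∀ {φ : Y.Realization}, f.realize φ ∈ X.openStar v →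
      ∃ a : ι, φ ∈ Y.openStar a.1 := by
    intro φ hφ
    have h1 := (f.realize φ).mem_support_iff.2 hφ
    rw [support_realize] at h1
    obtain ⟨a, ha, rfl⟩ := Finset.mem_image.1 h1
    exact ⟨⟨a, rfl⟩, φ.mem_support_iff.1 ha⟩
  rcases isEmpty_or_nonempty ι with hι | hι
  · refine IsEvenlyCovered.to_isEvenlyCovered_preimage
      (IsEvenlyCovered.of_preimage_eq_empty ι ((isOpen_openStar v).mem_nhds hxv) ?_)
    refine Set.eq_empty_of_forall_notMem fun φ hφ => ?_
    exact hι.elim (hmem hφ).choose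
  · have : Nonempty (X.Realization → Y.Realization) :=
      ⟨fun _ => vertex Y hι.some.1⟩
    -- The sheets over the open star of `v` are the open stars of the vertices over `v`.
    refine IsEvenlyCovered.to_isEvenlyCovered_preimage (IsEvenlyCovered.of_trivialization
      (t := (isOpen_openStar v).trivializationDiscrete (f := f.realize) (ι := ι)
        (fun a => Y.openStar a.1) (X.openStar v) ?_ ?_ ?_ ?_ ?_) ?_)
    · rintro ⟨a, rfl⟩ U hU
      refine ⟨fun h => (h.preimage (continuous_realize f)).inter (isOpen_openStar a), fun h => ?_⟩
      refine isOpen_realization_iff.2 fun s => ?_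
      by_cases has : f.toFun a ∈ (s : Finset V)
      · obtain ⟨g, hg, hgf, hga⟩ := exists_lift_simplex hf hY s has
        have : X.simplexInclusion s ⁻¹' U = g ⁻¹' (f.realize ⁻¹' U ∩ Y.openStar a) := by
          ext y
          simp only [Set.mem_preimage, Set.mem_inter_iff, hgf]
          refine ⟨fun h => ⟨h, ?_⟩, fun h => h.1⟩
          have := hU h
          change 0 < (g y).coord a
          rw [hga]
          exact this
        rw [this]
        exact h.preimage hg
      · have : X.simplexInclusion s ⁻¹' U = ∅ := by
          refine Set.eq_empty_of_forall_notMem fun y hy => has ?_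
          exact X.support_simplexInclusion_subset s y ((Realization.mem_support_iff _).2 (hU hy))
        rw [this]
        exact isOpen_empty
    · exact fun a => injOn_realize_openStar hf a.1
    · rintro ⟨a, rfl⟩ y hy
      have has : f.toFun a ∈ y.coord.support := y.mem_support_iff.2 hy
      obtain ⟨g, hg, hgf, hga⟩ := exists_lift_simplex hf hY ⟨_, y.support_mem⟩ has
      obtain ⟨z, hz⟩ := X.exists_simplexInclusion_eq ⟨_, y.support_mem⟩ (x := y) subset_rfl
      refine ⟨g z, ?_, (hgf z).trans hz⟩
      change 0 < (g z).coord a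
      rw [hga, hz]
      exact hy
    · intro a b hab
      refine Set.disjoint_left.2 fun φ ha hb => hab (Subtype.ext ?_)
      exact injOn_of_mem_face hf φ.support_mem (φ.mem_support_iff.2 ha) (φ.mem_support_iff.2 hb)
        (a.2.trans b.2.symm)
    · intro φ hφ
      exact Set.mem_iUnion.2 (hmem hφ)
    · exact hxv

end cover

end AbstractSimplicialComplex
-- Covering maps of realizations give triangle covers
namespace AbstractSimplicialComplex

variable {V : Type u} {W : Type w}

open Realization

variable {X : AbstractSimplicialComplex V} {Y : AbstractSimplicialComplex W}

theorem Realization.eq_vertex {x : X.Realization} {v : V} (h : x.coord.support ⊆ {v}) :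
    x = vertex X v := by
  refine ext_coord fun u => ?_
  rw [vertex_coord]
  split_ifs with hu
  · subst hu
    simpa using x.sum_eq_of_support_subset h
  · exact Finsupp.notMem_support_iff.1 fun h' => hu (Finset.mem_singleton.1 (h h'))

theorem Realization.vertex_injective : Function.Injective (vertex X) := by
  intro a b h
  have := congrArg (fun x : X.Realization => x.coord.support) h
  simpa [support_vertex] using this

theorem realize_vertex (f : SimplicialMap Y X) (a : W) :
    f.realize (vertex Y a) = vertex X (f.toFun a) :=
  eq_vertex (by rw [support_realize, support_vertex, Finset.image_singleton])

theorem realize_segment_coord (f : SimplicialMap Y X) {s : Finset W} (hs : s ∈ Y.faces)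
    {x y : Y.Realization} (hx : x.coord.support ⊆ s) (hy : y.coord.support ⊆ s)
    (t : unitInterval) (v : V) :
    (f.realize (segment s hs x y hx hy t)).coord v =
      (1 - t) * (f.realize x).coord v + t * (f.realize y).coord v := by
  have hsub : (segment s hs x y hx hy t).coord.support ⊆ s := by
    intro a ha
    by_contra h
    rw [Finsupp.mem_support_iff, segment_coord, Finsupp.notMem_support_iff.1 fun h' => h (hx h'),
      Finsupp.notMem_support_iff.1 fun h' => h (hy h')] at ha
    simp at ha
  rw [realize_coord f _ hsub, realize_coord f _ hx, realize_coord f _ hy, Finset.mul_sum,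
    Finset.mul_sum, ← Finset.sum_add_distrib]
  refine Finset.sum_congr rfl fun a _ => ?_
  rw [segment_coord]
  split_ifs <;> ring

section covering

variable {f : SimplicialMap Y X} (hf : IsCoveringMap f.realize)
include hf

/-- The segment joining two vertices with the same image would project to a constant path, hence be
constant. -/
theorem injOn_of_isCoveringMap {s : Finset W} (hs : s ∈ Y.faces) : Set.InjOn f.toFun s := by
  intro a ha b hb hab
  have hxa : (vertex Y a).coord.support ⊆ s := by
    rw [support_vertex]; exact Finset.singleton_subset_iff.2 ha
  have hxb : (vertex Y b).coord.support ⊆ s := by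
    rw [support_vertex]; exact Finset.singleton_subset_iff.2 hb
  have h := hf.const_of_comp (continuous_segment hs hxa hxb) (fun t t' => ext_coord fun v => by
    simp only [realize_segment_coord, realize_vertex, hab]
    ring) 0 1
  rw [segment_zero, segment_one] at h
  exact vertex_injective h

/-- The segments from `a` to `b` and to `c` lift the same path from the same starting point. -/
theorem eq_of_adj_of_isCoveringMap {a b c : W} (hab : Y.oneSkeleton.Adj a b)
    (hac : Y.oneSkeleton.Adj a c) (hbc : f.toFun b = f.toFun c) : b = c := by
  have hsub : ∀ {d e : W}, d ∈ ({a, e} : Finset W) → (vertex Y d).coord.support ⊆ {a, e} := by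
    intro d e hd
    rw [support_vertex]
    exact Finset.singleton_subset_iff.2 hd
  have h := hf.eq_of_comp_eq
    (continuous_segment hab.2 (hsub (d := a) (by simp)) (hsub (d := b) (by simp)))
    (continuous_segment hac.2 (hsub (d := a) (by simp)) (hsub (d := c) (by simp)))
    (funext fun t => ext_coord fun v => by
      simp only [Function.comp_apply, realize_segment_coord, realize_vertex, hbc])
    0 (by rw [segment_zero, segment_zero])
  have h1 := congrFun h 1
  rw [segment_one, segment_one] at h1
  exact vertex_injective h1

/-- Lift the segment from the vertex to the barycenter of `s`. At a small positive time the lift is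
still in the open star of `a`, while its image is already interior to `s`; its support is the
required face. -/
theorem exists_lift_face_of_isCoveringMap {s : Finset V} (hs : s ∈ X.faces) {a : W}
    (ha : f.toFun a ∈ s) : ∃ t ∈ Y.faces, a ∈ t ∧ t.image f.toFun = s := by
  have hx : (vertex X (f.toFun a)).coord.support ⊆ s := by
    rw [support_vertex]; exact Finset.singleton_subset_iff.2 ha
  have hy := (support_barycenter s hs).le
  let γ : C(unitInterval, X.Realization) := ⟨_, continuous_segment hs hx hy⟩
  obtain ⟨Γ, hΓ, hΓ0⟩ := hf.exists_path_lifts γ (vertex Y a)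
    ((segment_zero hs hx hy).trans (realize_vertex f a).symm)
  have hU : IsOpen (Γ ⁻¹' Y.openStar a) := (isOpen_openStar a).preimage Γ.continuous
  have h0 : (0 : unitInterval) ∈ closure (Set.Ioi 0) := by
    rw [closure_Ioi' ⟨1, zero_lt_one⟩]
    exact Set.self_mem_Ici
  obtain ⟨t, ht, ht0⟩ := mem_closure_iff.1 h0 _ hU (by
    change 0 < (Γ 0).coord a
    rw [hΓ0, vertex_coord, if_pos rfl]
    exact zero_lt_one)
  refine ⟨(Γ t).coord.support, (Γ t).support_mem, (Γ t).mem_support_iff.2 ht, ?_⟩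
  rw [← support_realize, ← Function.comp_apply (f := f.realize), hΓ]
  ext v
  rw [Realization.mem_support_iff]
  change 0 < (segment s hs _ _ hx hy t).coord v ↔ _
  rw [segment_coord]
  have h1 : 0 ≤ (1 - (t : ℝ)) * (vertex X (f.toFun a)).coord v :=
    mul_nonneg (sub_nonneg.2 t.2.2) (Realization.nonneg _ _)
  constructor
  · intro h
    by_contra hv
    rw [Finsupp.notMem_support_iff.1 fun h' => hv (hx h'),
      Finsupp.notMem_support_iff.1 fun h' => hv (hy h')] at h
    simp at h
  · intro hv
    have h2 : 0 < (barycenter s hs).coord v :=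
      (Realization.mem_support_iff _).1 (by rwa [support_barycenter])
    have ht0' : (0 : ℝ) < t := ht0
    have := mul_pos ht0' h2
    linarith

theorem mem_of_mem_image_of_adj {a b : W} {t : Finset W} (ht : t ∈ Y.faces) (ha : a ∈ t)
    (hab : Y.oneSkeleton.Adj a b) (hb : f.toFun b ∈ t.image f.toFun) : b ∈ t := by
  obtain ⟨c, hc, hcb⟩ := Finset.mem_image.1 hb
  have hac : a ≠ c := by
    rintro rfl
    exact hab.ne (injOn_of_isCoveringMap hf hab.2 (by simp) (by simp) hcb)
  rw [← eq_of_adj_of_isCoveringMap hf (adj_of_mem_face ht ha hc hac) hab hcb]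
  exact hc

theorem adj_map_of_isCoveringMap {a b : W} (hab : Y.oneSkeleton.Adj a b) :
    X.oneSkeleton.Adj (f.toFun a) (f.toFun b) := by
  refine adj_of_mem_face (f.map_faces _ hab.2) (Finset.mem_image_of_mem _ (by simp))
    (Finset.mem_image_of_mem _ (by simp)) fun h => ?_
  exact hab.ne (injOn_of_isCoveringMap hf hab.2 (by simp) (by simp) h)

/-- A simplicial map that induces a covering map of realizations is an isomorphism on closed
neighbourhoods of the `1`-skeleta if the target is flag. -/
theorem triangleCover_of_isCoveringMap (hX : X.IsFlag) :
    Y.oneSkeleton.TriangleCover X.oneSkeleton f.toFun where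
  hom := adj_map_of_isCoveringMap hf
  inj := eq_of_adj_of_isCoveringMap hf
  full := by
    intro a b c hab hac hbc
    have hab' := adj_map_of_isCoveringMap hf hab
    have hac' := adj_map_of_isCoveringMap hf hac
    have hs : ({f.toFun a, f.toFun b, f.toFun c} : Finset V) ∈ X.faces := by
      refine hX.mem_of_near ⟨f.toFun a, by simp⟩ fun u hu v hv => ?_
      simp only [Finset.mem_insert, Finset.mem_singleton] at hu hv
      rcases hu with rfl | rfl | rfl <;> rcases hv with rfl | rfl | rfl <;>
      first
      | exact Or.inl rfl
      | exact Or.inr (by assumption)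
      | exact Or.inr (SimpleGraph.Adj.symm (by assumption))
    obtain ⟨t, ht, hat, hts⟩ := exists_lift_face_of_isCoveringMap hf hs (a := a) (by simp)
    refine adj_of_mem_face ht (mem_of_mem_image_of_adj hf ht hat hab (by rw [hts]; simp))
      (mem_of_mem_image_of_adj hf ht hat hac (by rw [hts]; simp)) ?_
    rintro rfl
    exact hbc.ne rfl
  surj := by
    intro a z haz
    obtain ⟨t, ht, hat, hts⟩ := exists_lift_face_of_isCoveringMap hf haz.2 (a := a) (by simp)
    have hz : z ∈ t.image f.toFun := by rw [hts]; simp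
    obtain ⟨b, hb, rfl⟩ := Finset.mem_image.1 hz
    refine ⟨b, adj_of_mem_face ht hat hb ?_, rfl⟩
    rintro rfl
    exact haz.ne rfl

/-- The image of a clique is a face, which lifts to a face through `a`. Unique lifting of edges at
`a` puts the whole clique in that face. -/
theorem isFlag_of_isCoveringMap (hX : X.IsFlag) : Y.IsFlag := by
  rintro s ⟨a, ha⟩ hcl
  have hs : s.image f.toFun ∈ X.faces := by
    refine hX.mem_of_near ⟨_, Finset.mem_image_of_mem _ ha⟩ fun u hu v hv => ?_
    obtain ⟨b, hb, rfl⟩ := Finset.mem_image.1 hu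
    obtain ⟨c, hc, rfl⟩ := Finset.mem_image.1 hv
    by_cases hbc : b = c
    · exact Or.inl (congrArg _ hbc)
    · exact Or.inr (adj_map_of_isCoveringMap hf (hcl hb hc hbc))
  obtain ⟨t, ht, hat, hts⟩ := exists_lift_face_of_isCoveringMap hf hs
    (Finset.mem_image_of_mem _ ha)
  refine (Y.isRelLowerSet_faces ht).2 (fun b hb => ?_) ⟨a, ha⟩
  by_cases hab : a = b
  · exact hab ▸ hat
  · exact mem_of_mem_image_of_adj hf ht hat (hcl ha hb hab)
      (by rw [hts]; exact Finset.mem_image_of_mem _ hb)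

/-- A covering map from a path connected realization to a simply connected one is injective on
vertices. -/
theorem injective_of_isCoveringMap [PathConnectedSpace Y.Realization]
    [SimplyConnectedSpace X.Realization] : Function.Injective f.toFun := by
  intro a b hab
  have hval : f.realize (vertex Y a) = f.realize (vertex Y b) := by
    rw [realize_vertex, realize_vertex, hab]
  let γ : Path (vertex Y a) (vertex Y b) := PathConnectedSpace.somePath _ _
  -- The projected path is a null-homotopic loop, so its lift `γ` ends where the constant lift does.
  have hhom := SimplyConnectedSpace.paths_homotopic
    ((γ.map hf.continuous).cast rfl hval) (Path.refl (f.realize (vertex Y a)))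
  have h := hf.liftPath_apply_one_eq_of_homotopicRel hhom (vertex Y a) (by simp) (by simp)
  have h1 : γ.toContinuousMap = hf.liftPath ((γ.map hf.continuous).cast rfl hval).toContinuousMap
      (vertex Y a) (by simp) :=
    (hf.eq_liftPath_iff' _).2 ⟨rfl, γ.source⟩
  have h2 : ContinuousMap.const _ (vertex Y a) =
      hf.liftPath (Path.refl (f.realize (vertex Y a))).toContinuousMap
      (vertex Y a) (by simp) :=
    (hf.eq_liftPath_iff' _).2 ⟨rfl, rfl⟩
  rw [← h1, ← h2] at h
  exact vertex_injective (h.symm.trans γ.target)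

end covering

/-- The `1`-skeleton of a complex with connected realization is connected. -/
theorem connected_oneSkeleton [ConnectedSpace Y.Realization] : Y.oneSkeleton.Connected := by
  -- A closed simplex meeting a union of components lies in it, so openness can be checked simplex
  -- by simplex.
  have hopen : ∀ C : Set W, (∀ a b, a ∈ C → Y.oneSkeleton.Adj a b → b ∈ C) →
      IsOpen {x : Y.Realization | (x.coord.support : Set W) ⊆ C} := by
    intro C hC
    refine isOpen_realization_iff.2 fun s => ?_
    have hsub : ∀ a ∈ (s : Finset W), a ∈ C → ((s : Finset W) : Set W) ⊆ C := by
      intro a ha haC b hb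
      rcases near_of_mem_face s.2 ha hb with rfl | h
      · exact haC
      · exact hC _ _ haC h
    by_cases hs : ((s : Finset W) : Set W) ⊆ C
    · convert isOpen_univ
      exact Set.eq_univ_of_forall fun x =>
        (Finset.coe_subset.2 (Y.support_simplexInclusion_subset s x)).trans hs
    · convert isOpen_empty
      refine Set.eq_empty_of_forall_notMem fun x hx => hs ?_
      obtain ⟨a, ha⟩ := (Y.isRelLowerSet_faces (Y.simplexInclusion s x).support_mem).1
      exact hsub a (Y.support_simplexInclusion_subset s x ha) (hx ha)
  obtain ⟨x⟩ := (inferInstance : Nonempty Y.Realization)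
  obtain ⟨v, -⟩ := (Y.isRelLowerSet_faces x.support_mem).1
  refine (SimpleGraph.connected_iff_exists_forall_reachable _).2 ⟨v, fun b => ?_⟩
  let C : Set W := {b | Y.oneSkeleton.Reachable v b}
  have hC : ∀ a b, a ∈ C → Y.oneSkeleton.Adj a b → b ∈ C :=
    fun a b ha hab => SimpleGraph.Reachable.trans ha hab.reachable
  have hC' : ∀ a b, a ∈ Cᶜ → Y.oneSkeleton.Adj a b → b ∈ Cᶜ :=
    fun a b ha hab hb => ha (hC b a hb hab.symm)
  have hclopen : IsClopen {x : Y.Realization | (x.coord.support : Set W) ⊆ C} := by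
    refine ⟨⟨?_⟩, hopen C hC⟩
    convert hopen Cᶜ hC' using 1
    ext x
    obtain ⟨a, ha⟩ := (Y.isRelLowerSet_faces x.support_mem).1
    simp only [Set.mem_compl_iff, Set.mem_ofPred_eq]
    constructor
    · intro h b hb hbC
      refine h fun c hc => ?_
      rcases near_of_mem_face x.support_mem hb hc with rfl | h
      · exact hbC
      · exact hC _ _ hbC h
    · intro h h'
      exact h ha (h' ha)
  have huniv := hclopen.eq_univ ⟨vertex Y v, by
    change ((vertex Y v).coord.support : Set W) ⊆ C
    rw [support_vertex, Finset.coe_singleton]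
    exact Set.singleton_subset_iff.2 (SimpleGraph.Reachable.refl v)⟩
  have hb : vertex Y b ∈ {x : Y.Realization | (x.coord.support : Set W) ⊆ C} := by
    rw [huniv]; trivial
  change ((vertex Y b).coord.support : Set W) ⊆ C at hb
  rw [support_vertex, Finset.coe_singleton] at hb
  have hbC : b ∈ C := Set.singleton_subset_iff.1 hb
  exact hbC

end AbstractSimplicialComplex
-- Pushing the outer sphere inwards
namespace SimpleGraph

variable {W : Type w} {G : SimpleGraph W} {o : W} {l : W → ℕ}

/-- A clique in a sphere has a common neighbour in the previous sphere. -/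
theorem IsLevel.exists_common_lower (hl : G.IsLevel o l) (h4 : G.NoFourWheel) {s : Finset W}
    (hs : s.Nonempty) (hcl : ∀ a ∈ s, ∀ b ∈ s, G.Near a b) {k : ℕ}
    (hk : ∀ a ∈ s, l a = k + 1) : ∃ c, l c = k ∧ ∀ a ∈ s, G.Adj a c := by
  suffices h : ∀ t ⊆ s, t.Nonempty → ∃ c, l c = k ∧ ∀ a ∈ t, G.Adj a c from h s subset_rfl hs
  intro t
  induction t using Finset.induction_on with
  | empty => exact fun _ h => absurd h (by simp)
  | insert w t hwt ih =>
    intro hts _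
    have hw : w ∈ s := hts (Finset.mem_insert_self _ _)
    have hts' : t ⊆ s := (Finset.subset_insert _ _).trans hts
    rcases t.eq_empty_or_nonempty with rfl | ⟨a, ha⟩
    · obtain ⟨c, hc, hlc⟩ := hl.down (hk w hw)
      exact ⟨c, hlc, by simpa using hc⟩
    · obtain ⟨c, hc, hct⟩ := ih hts' ⟨a, ha⟩
      by_cases hwc : G.Adj w c
      · exact ⟨c, hc, by simpa [hwc] using hct⟩
      have adj : ∀ b ∈ t, G.Adj w b := fun b hb =>
        (hcl w hw b (hts' hb)).resolve_left (by rintro rfl; exact hwt hb)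
      obtain ⟨d, hd, hwd, had⟩ := hl.edge (adj a ha) (hk w hw) (hk a (hts' ha))
      refine ⟨d, hd, fun b hb => ?_⟩
      rcases Finset.mem_insert.1 hb with rfl | hb
      · exact hwd
      by_cases hab : a = b
      · exact hab ▸ had
      by_contra hbd
      have hab' : G.Adj a b := (hcl a (hts' ha) b (hts' hb)).resolve_left hab
      have hcd : G.Adj c d := by
        refine (hl.low (hk a (hts' ha)) (hct a ha) had hc hd).resolve_left ?_
        rintro rfl
        exact hwc hwd
      -- The hub `a` with rim `b, w, d, c` would be a 4-wheel, so `d` is adjacent to every `b` in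
      -- `t`.
      rcases h4 a b w d c hab' (adj a ha).symm had (hct a ha) (adj b hb).symm hwd hcd.symm
        (hct b hb).symm with (rfl | h) | (rfl | h)
      · have := hk b (hts' hb); omega
      · exact hbd h
      · have := hk w hw; omega
      · exact hwc h

theorem IsLevel.finite_lower (hl : G.IsLevel o l) (hfin : ∀ S : Set W, G.IsClique S → S.Finite)
    {a : W} {k : ℕ} (hk : l a = k + 1) : {c | l c = k ∧ G.Adj a c}.Finite :=
  hfin _ fun _ hb _ hc hbc => (hl.low hk hb.2 hc.2 hb.1 hc.1).resolve_left hbc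

end SimpleGraph

namespace AbstractSimplicialComplex

variable {W : Type w} {Y : AbstractSimplicialComplex W}

namespace Realization

/-- A barycentric coordinate as a nonnegative real. -/
def nncoord (x : Y.Realization) (v : W) : NNReal := ⟨x.coord v, x.nonneg v⟩

theorem nncoord_ne_zero_iff (x : Y.Realization) {v : W} :
    x.nncoord v ≠ 0 ↔ v ∈ x.coord.support := by
  rw [Finsupp.mem_support_iff, Ne, ← NNReal.coe_eq_zero]
  rfl

theorem nncoord_eq_zero (x : Y.Realization) {v : W} (h : v ∉ x.coord.support) :
    x.nncoord v = 0 :=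
  not_not.1 (mt x.nncoord_ne_zero_iff.1 h)

theorem nncoord_le_one (x : Y.Realization) (v : W) : x.nncoord v ≤ 1 := by
  by_cases h : v ∈ x.coord.support
  · refine NNReal.coe_le_coe.1 ?_
    change x.coord v ≤ 1
    rw [← x.sum_eq_of_support_subset subset_rfl]
    exact Finset.single_le_sum (fun a _ => x.nonneg a) h
  · rw [x.nncoord_eq_zero h]
    exact zero_le_one

theorem sum_nncoord (x : Y.Realization) {s : Finset W} (hs : x.coord.support ⊆ s) :
    ∑ v ∈ s, x.nncoord v = 1 := by
  rw [← NNReal.coe_inj, NNReal.coe_sum]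
  exact x.sum_eq_of_support_subset hs

variable (l : W → ℕ) (k : ℕ)

/-- The largest coordinate of `x` at a vertex of level `k + 1` satisfying `P`. -/
def levelSup (x : Y.Realization) (P : W → Prop) : NNReal :=
  (x.coord.support.filter fun w => l w = k + 1 ∧ P w).sup x.nncoord

/-- Replacing the support by a fixed finite set makes continuity in `x` visible. -/
theorem levelSup_eq (x : Y.Realization) (P : W → Prop) {s : Finset W}
    (hs : x.coord.support ⊆ s) :
    x.levelSup l k P = (s.filter fun w => l w = k + 1 ∧ P w).sup x.nncoord := by
  refine le_antisymm (Finset.sup_mono (Finset.filter_subset_filter _ hs))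
    (Finset.sup_le fun w hw => ?_)
  by_cases h : w ∈ x.coord.support
  · exact Finset.le_sup (f := x.nncoord) (Finset.mem_filter.2 ⟨h, (Finset.mem_filter.1 hw).2⟩)
  · rw [x.nncoord_eq_zero h]
    exact zero_le

theorem le_levelSup (x : Y.Realization) {P : W → Prop} {w : W} (hw : l w = k + 1) (hP : P w) :
    x.nncoord w ≤ x.levelSup l k P := by
  by_cases h : w ∈ x.coord.support
  · exact Finset.le_sup (f := x.nncoord) (Finset.mem_filter.2 ⟨h, hw, hP⟩)
  · rw [x.nncoord_eq_zero h]
    exact zero_le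

theorem exists_eq_levelSup (x : Y.Realization) {P : W → Prop} (h : x.levelSup l k P ≠ 0) :
    ∃ w ∈ x.coord.support, l w = k + 1 ∧ P w ∧ x.nncoord w = x.levelSup l k P := by
  have hne : (x.coord.support.filter fun w => l w = k + 1 ∧ P w).Nonempty := by
    rw [Finset.nonempty_iff_ne_empty]
    intro he
    exact h (by rw [levelSup, he, Finset.sup_empty, bot_eq_zero])
  obtain ⟨w, hw, he⟩ := Finset.exists_mem_eq_sup _ hne x.nncoord
  obtain ⟨h1, h2, h3⟩ := Finset.mem_filter.1 hw
  exact ⟨w, h1, h2, h3, he.symm⟩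

/-- Unnormalized coordinates of the deformation of the ball of radius `k + 1` to the ball of
radius `k`: the coordinates at level `k + 1` are lowered by `s`, and a vertex `v` of level `k`
gains weight as soon as it is adjacent to all the remaining vertices of level `k + 1`. -/
def push (x : Y.Realization) (s : NNReal) (v : W) : NNReal :=
  if l v = k + 1 then x.nncoord v - s else
    x.nncoord v + if l v = k then
      min s (x.levelSup l k fun _ => True) - x.levelSup l k fun w => ¬ Y.oneSkeleton.Adj v w
    else 0

variable {l k}

theorem push_ne_zero {x : Y.Realization} {s : NNReal} {v : W} (h : x.push l k s v ≠ 0) :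
    (v ∈ x.coord.support ∧ (l v = k + 1 → s < x.nncoord v)) ∨
    (l v = k ∧ x.levelSup l k (fun w => ¬ Y.oneSkeleton.Adj v w) <
      min s (x.levelSup l k fun _ => True)) := by
  unfold push at h
  split_ifs at h with h1 h2
  · have : s < x.nncoord v := tsub_pos_iff_lt.1 (pos_iff_ne_zero.2 h)
    exact Or.inl ⟨x.nncoord_ne_zero_iff.1 (ne_of_gt (lt_of_le_of_lt zero_le this)),
      fun _ => this⟩
  · by_cases h3 : x.nncoord v = 0
    · rw [h3, zero_add] at h
      exact Or.inr ⟨h2, tsub_pos_iff_lt.1 (pos_iff_ne_zero.2 h)⟩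
    · exact Or.inl ⟨x.nncoord_ne_zero_iff.1 h3, fun h => absurd h h1⟩
  · rw [add_zero] at h
    exact Or.inl ⟨x.nncoord_ne_zero_iff.1 h, fun h => absurd h h1⟩

theorem push_eq_of_levelSup_eq_zero {x : Y.Realization} {s : NNReal}
    (h : min s (x.levelSup l k fun _ => True) = 0) (v : W) : x.push l k s v = x.nncoord v := by
  unfold push
  rw [h, zero_tsub, ite_self, add_zero]
  split_ifs with hv
  · rcases min_eq_bot.1 (h.trans bot_eq_zero.symm) with h | h
    · rw [h, bot_eq_zero, tsub_zero]
    · have := (x.le_levelSup l k (P := fun _ => True) hv trivial).trans h.le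
      rw [le_bot_iff.1 this, bot_eq_zero, zero_tsub]
  · rfl

theorem exists_adj_of_lt_min {x : Y.Realization} {s : NNReal} {v : W}
    (h : x.levelSup l k (fun w => ¬ Y.oneSkeleton.Adj v w) <
      min s (x.levelSup l k fun _ => True)) :
    ∀ w, l w = k + 1 → x.nncoord w = x.levelSup l k (fun _ => True) →
      Y.oneSkeleton.Adj w v := by
  intro w hw he
  by_contra hne
  have := x.le_levelSup l k (P := fun w => ¬ Y.oneSkeleton.Adj v w) hw fun h => hne h.symm
  rw [he] at this
  exact absurd (lt_of_le_of_lt this h) (not_lt_of_ge (min_le_right _ _))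

variable {o : W} (hl : Y.oneSkeleton.IsLevel o l)
include hl

/-- A vertex gains weight only if every outer vertex not adjacent to it has coordinate below both
`s` and the outer maximum. So it is adjacent to all surviving outer vertices and to each maximal
one, `w`; vertices of level `k` adjacent to `w` are pairwise near by `low`. -/
theorem near_of_push_ne_zero {x : Y.Realization} (hx : ∀ v ∈ x.coord.support, l v ≤ k + 1)
    {s : NNReal} {a b : W} (ha : x.push l k s a ≠ 0) (hb : x.push l k s b ≠ 0) :
    Y.oneSkeleton.Near a b := by
  have top : ∀ {v : W}, x.levelSup l k (fun w => ¬ Y.oneSkeleton.Adj v w) <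
      min s (x.levelSup l k fun _ => True) → ∃ w ∈ x.coord.support, l w = k + 1 ∧
        x.nncoord w = x.levelSup l k fun _ => True := by
    intro v h
    obtain ⟨w, h1, h2, -, h3⟩ := x.exists_eq_levelSup l k (P := fun _ => True)
      (ne_of_gt (lt_of_le_of_lt zero_le (lt_of_lt_of_le h (min_le_right _ _))))
    exact ⟨w, h1, h2, h3⟩
  have mixed : ∀ {a b : W}, (a ∈ x.coord.support ∧ (l a = k + 1 → s < x.nncoord a)) →
      (l b = k ∧ x.levelSup l k (fun w => ¬ Y.oneSkeleton.Adj b w) <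
        min s (x.levelSup l k fun _ => True)) → Y.oneSkeleton.Near a b := by
    rintro a b ⟨ha, ha'⟩ ⟨hb, hb'⟩
    by_cases hla : l a = k + 1
    · by_contra hne
      have := x.le_levelSup l k (P := fun w => ¬ Y.oneSkeleton.Adj b w) hla
        fun h => hne (Or.inr h.symm)
      exact absurd ((ha' hla).trans (lt_of_le_of_lt this hb')) (not_lt_of_ge (min_le_left _ _))
    · obtain ⟨w, hw, hlw, he⟩ := top hb'
      have hwa : Y.oneSkeleton.Adj w a := (near_of_mem_face x.support_mem hw ha).resolve_left
        (by rintro rfl; exact hla hlw)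
      have h1 := hl.step hwa.symm
      have h2 := hx a ha
      exact hl.low hlw hwa (exists_adj_of_lt_min hb' w hlw he) (by omega) hb
  rcases push_ne_zero ha with ha | ha <;> rcases push_ne_zero hb with hb | hb
  · exact near_of_mem_face x.support_mem ha.1 hb.1
  · exact mixed ha hb
  · exact (mixed hb ha).symm
  · obtain ⟨w, hw, hlw, he⟩ := top ha.2
    exact hl.low hlw (exists_adj_of_lt_min ha.2 w hlw he)
      (exists_adj_of_lt_min hb.2 w hlw he) ha.1 hb.1

/-- A common lower neighbour of all outer vertices gains the full `min s M`, with `M` the largest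
outer coordinate. If that is zero, nothing has moved. -/
theorem exists_push_ne_zero (h4 : Y.oneSkeleton.NoFourWheel) (x : Y.Realization) (s : NNReal) :
    ∃ v, x.push l k s v ≠ 0 := by
  by_contra! h
  let A := x.coord.support.filter fun w => l w = k + 1
  rcases A.eq_empty_or_nonempty with hA | hA
  · obtain ⟨v, hv⟩ := (Y.isRelLowerSet_faces x.support_mem).1
    have hlv : l v ≠ k + 1 := fun hlv => by
      have : v ∈ A := Finset.mem_filter.2 ⟨hv, hlv⟩
      rw [hA] at this
      simp at this
    have := h v
    rw [push, if_neg hlv, add_eq_zero] at this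
    exact x.nncoord_ne_zero_iff.2 hv this.1
  · have hmem : ∀ a ∈ A, a ∈ x.coord.support ∧ l a = k + 1 := fun a ha => Finset.mem_filter.1 ha
    obtain ⟨c, hc, hcA⟩ := hl.exists_common_lower h4 hA
      (fun a ha b hb => near_of_mem_face x.support_mem (hmem a ha).1 (hmem b hb).1)
      (fun a ha => (hmem a ha).2)
    have hN : x.levelSup l k (fun w => ¬ Y.oneSkeleton.Adj c w) = 0 := by
      by_contra hne
      obtain ⟨w, hw, hlw, hcw, -⟩ := x.exists_eq_levelSup l k hne
      exact hcw (hcA w (Finset.mem_filter.2 ⟨hw, hlw⟩)).symm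
    have h1 := h c
    rw [push, if_neg (by omega), if_pos hc, hN, tsub_zero, add_eq_zero] at h1
    obtain ⟨w, hw⟩ := hA
    refine x.nncoord_ne_zero_iff.2 (hmem w hw).1 ?_
    rw [← push_eq_of_levelSup_eq_zero h1.2 w]
    exact h w

/-- A vertex gaining weight is a lower neighbour of an outer vertex of `t`, and there are finitely
many of these because they form a clique. -/
theorem exists_finset_push (hfin : ∀ S : Set W, Y.oneSkeleton.IsClique S → S.Finite)
    (t : Finset W) : ∃ F : Finset W, t ⊆ F ∧ ∀ x : Y.Realization, x.coord.support ⊆ t →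
      ∀ s v, x.push l k s v ≠ 0 → v ∈ F := by
  have hF : (⋃ w ∈ t.filter (fun w => l w = k + 1),
      {c | l c = k ∧ Y.oneSkeleton.Adj w c}).Finite :=
    (t.filter _).finite_toSet.biUnion fun w hw =>
      hl.finite_lower hfin (Finset.mem_filter.1 hw).2
  refine ⟨t ∪ hF.toFinset, Finset.subset_union_left, fun x hx s v hv => ?_⟩
  rcases push_ne_zero hv with h | ⟨h, h'⟩
  · exact Finset.mem_union_left _ (hx h.1)
  · obtain ⟨w, hw, hlw, -, he⟩ := x.exists_eq_levelSup l k (P := fun _ => True)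
      (ne_of_gt (lt_of_le_of_lt zero_le (lt_of_lt_of_le h' (min_le_right _ _))))
    refine Finset.mem_union_right _ (hF.mem_toFinset.2 (Set.mem_biUnion
      (Finset.mem_filter.2 ⟨hx hw, hlw⟩) ⟨h, exists_adj_of_lt_min h' w hlw he⟩))

/-- Existence of the normalized point of the deformation. -/
theorem exists_push (hY : Y.IsFlag) (hfin : ∀ S : Set W, Y.oneSkeleton.IsClique S → S.Finite)
    (h4 : Y.oneSkeleton.NoFourWheel) (x : Y.Realization)
    (hx : ∀ v ∈ x.coord.support, l v ≤ k + 1) (s : NNReal) :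
    ∃ z : Y.Realization, ∀ F : Finset W, (∀ v, x.push l k s v ≠ 0 → v ∈ F) →
      0 < ∑ a ∈ F, x.push l k s a ∧
      ∀ v, z.nncoord v = x.push l k s v / ∑ a ∈ F, x.push l k s a := by
  obtain ⟨F₀, -, hF₀⟩ := exists_finset_push (k := k) hl hfin x.coord.support
  let T := F₀.filter fun v => x.push l k s v ≠ 0
  have hT : ∀ v, v ∈ T ↔ x.push l k s v ≠ 0 := fun v =>
    Finset.mem_filter.trans ⟨fun h => h.2, fun h => ⟨hF₀ x subset_rfl s v h, h⟩⟩
  obtain ⟨v₀, hv₀⟩ := exists_push_ne_zero hl h4 (k := k) x s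
  have hface : T ∈ Y.faces := hY.mem_of_near ⟨v₀, (hT v₀).2 hv₀⟩ fun a ha b hb =>
    near_of_push_ne_zero hl hx ((hT a).1 ha) ((hT b).1 hb)
  -- The normalizing sum does not depend on `F`, so one `F` can later serve a whole family of
  -- points.
  have hsum : ∀ F : Finset W, (∀ v, x.push l k s v ≠ 0 → v ∈ F) →
      ∑ a ∈ F, x.push l k s a = ∑ a ∈ T, x.push l k s a := fun F hF =>
    (Finset.sum_subset (fun v hv => hF v ((hT v).1 hv)) fun v _ hv =>
      not_not.1 (mt (hT v).2 hv)).symm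
  have hpos : 0 < ∑ a ∈ T, x.push l k s a :=
    Finset.sum_pos (fun a ha => pos_iff_ne_zero.2 ((hT a).1 ha)) ⟨v₀, (hT v₀).2 hv₀⟩
  refine ⟨ofCoords T hface (fun v => ((x.push l k s v / ∑ a ∈ T, x.push l k s a : NNReal) : ℝ))
    (fun v => NNReal.coe_nonneg _) (fun v hv => ?_) ?_, fun F hF => ?_⟩
  · rw [not_not.1 (mt (hT v).2 hv), zero_div, NNReal.coe_zero]
  · rw [← NNReal.coe_sum, ← Finset.sum_div, div_self hpos.ne', NNReal.coe_one]
  · rw [hsum F hF]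
    exact ⟨hpos, fun v => NNReal.coe_injective rfl⟩

end Realization

end AbstractSimplicialComplex
-- The contraction and its continuity
namespace AbstractSimplicialComplex

variable {W : Type w} {Y : AbstractSimplicialComplex W}

namespace Realization

theorem ext_nncoord {x y : Y.Realization} (h : ∀ v, x.nncoord v = y.nncoord v) : x = y :=
  ext_coord fun v => congrArg NNReal.toReal (h v)

/-- A map to the realization that meets finitely many vertices and has continuous coordinates. -/
def Tame {Z : Type*} [TopologicalSpace Z] (g : Z → Y.Realization) : Prop :=
  ∃ F : Finset W, (∀ z, (g z).coord.support ⊆ F) ∧ ∀ v, Continuous fun z => (g z).nncoord v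

theorem Tame.continuous {Z : Type*} [TopologicalSpace Z] {g : Z → Y.Realization} (h : Tame g) :
    Continuous g := by
  obtain ⟨F, hF, hg⟩ := h
  exact continuous_of_coord F hF fun v _ => NNReal.continuous_coe.comp (hg v)

theorem Tame.comp {Z Z' : Type*} [TopologicalSpace Z] [TopologicalSpace Z'] {g : Z → Y.Realization}
    (h : Tame g) {e : Z' → Z} (he : Continuous e) : Tame (g ∘ e) := by
  obtain ⟨F, hF, hg⟩ := h
  exact ⟨F, fun z => hF (e z), fun v => (hg v).comp he⟩

theorem Tame.if_le {Z : Type*} [TopologicalSpace Z] {g h : Z → Y.Realization} (hg : Tame g)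
    (hh : Tame h) {c : ℝ} {θ : Z → ℝ} (hθ : Continuous θ) (he : ∀ z, c = θ z → g z = h z) :
    Tame fun z => if c ≤ θ z then g z else h z := by
  obtain ⟨F, hF, hg⟩ := hg
  obtain ⟨F', hF', hh⟩ := hh
  refine ⟨F ∪ F', fun z => ?_, fun v => ?_⟩
  · beta_reduce
    split_ifs
    · exact (hF z).trans Finset.subset_union_left
    · exact (hF' z).trans Finset.subset_union_right
  · have := Continuous.if_le (hg v) (hh v) continuous_const hθ (fun z hz => by rw [he z hz])
    refine this.congr fun z => ?_
    beta_reduce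
    split_ifs <;> rfl

theorem tame_simplexInclusion (s : Y.faces) : Tame (Y.simplexInclusion s) :=
  ⟨s, Y.support_simplexInclusion_subset s, fun v =>
    Continuous.subtype_mk ((continuous_coord v).comp (Y.continuous_simplexInclusion s)) _⟩

/-- The points of the realization supported at level at most `n`. -/
def InBall (l : W → ℕ) (n : ℕ) (x : Y.Realization) : Prop := ∀ v ∈ x.coord.support, l v ≤ n

theorem InBall.mono {l : W → ℕ} {m n : ℕ} {x : Y.Realization} (hx : x.InBall l m) (h : m ≤ n) :
    x.InBall l n := fun v hv => (hx v hv).trans h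

theorem InBall.levelSup_eq_zero {l : W → ℕ} {n : ℕ} {x : Y.Realization} (hx : x.InBall l n)
    (P : W → Prop) : x.levelSup l n P = 0 := by
  by_contra h
  obtain ⟨w, hw, hlw, -⟩ := x.exists_eq_levelSup l n h
  have := hx w hw
  omega

variable (l : W → ℕ) (k : ℕ)

/-- The deformation of the ball of radius `k + 1` to the ball of radius `k`. -/
def deform (x : Y.Realization) (s : NNReal) : Y.Realization :=
  if h : ∃ z : Y.Realization, ∀ F : Finset W, (∀ v, x.push l k s v ≠ 0 → v ∈ F) →
      0 < ∑ a ∈ F, x.push l k s a ∧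
      ∀ v, z.nncoord v = x.push l k s v / ∑ a ∈ F, x.push l k s a
  then h.choose else x

variable {l k} {o : W} (hl : Y.oneSkeleton.IsLevel o l) (hY : Y.IsFlag)
  (hfin : ∀ S : Set W, Y.oneSkeleton.IsClique S → S.Finite) (h4 : Y.oneSkeleton.NoFourWheel)
include hl hY hfin h4

theorem deform_spec {x : Y.Realization} (hx : x.InBall l (k + 1)) (s : NNReal) {F : Finset W}
    (hF : ∀ v, x.push l k s v ≠ 0 → v ∈ F) :
    0 < ∑ a ∈ F, x.push l k s a ∧
      ∀ v, (x.deform l k s).nncoord v = x.push l k s v / ∑ a ∈ F, x.push l k s a := by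
  have h := exists_push hl hY hfin h4 x hx s
  rw [deform, dif_pos h]
  exact h.choose_spec F hF

theorem push_ne_zero_of_mem_support_deform {x : Y.Realization} (hx : x.InBall l (k + 1))
    {s : NNReal} {v : W} (hv : v ∈ (x.deform l k s).coord.support) : x.push l k s v ≠ 0 := by
  obtain ⟨F, -, hF⟩ := exists_finset_push (k := k) hl hfin x.coord.support
  intro h
  refine (nncoord_ne_zero_iff _).2 hv ?_
  rw [(deform_spec hl hY hfin h4 hx s (hF x subset_rfl s)).2, h, zero_div]

theorem deform_eq_self {x : Y.Realization} (hx : x.InBall l (k + 1)) {s : NNReal}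
    (h : min s (x.levelSup l k fun _ => True) = 0) : x.deform l k s = x := by
  have hp := push_eq_of_levelSup_eq_zero h
  have hs := (deform_spec hl hY hfin h4 hx s (F := x.coord.support)
    (fun v hv => x.nncoord_ne_zero_iff.1 (by rwa [hp] at hv))).2
  refine ext_nncoord fun v => ?_
  rw [hs, hp, Finset.sum_congr rfl fun a _ => hp a, x.sum_nncoord subset_rfl, div_one]

theorem deform_zero {x : Y.Realization} (hx : x.InBall l (k + 1)) : x.deform l k 0 = x :=
  deform_eq_self hl hY hfin h4 hx (min_eq_left zero_le)

theorem deform_of_inBall {x : Y.Realization} (hx : x.InBall l k) (s : NNReal) :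
    x.deform l k s = x :=
  deform_eq_self hl hY hfin h4 (hx.mono k.le_succ) (by
    rw [hx.levelSup_eq_zero]
    exact min_eq_right zero_le)

/-- No coordinate exceeds 1, so lowering by 1 clears the outer level. -/
theorem inBall_deform_one {x : Y.Realization} (hx : x.InBall l (k + 1)) :
    (x.deform l k 1).InBall l k := by
  intro v hv
  rcases push_ne_zero (push_ne_zero_of_mem_support_deform hl hY hfin h4 hx hv) with ⟨h, h'⟩ | h
  · have h1 := hx v h
    by_contra hlt
    exact absurd (h' (by omega)) (not_lt_of_ge (x.nncoord_le_one v))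
  · exact h.1.le

/-- Over a fixed finite vertex set, the coordinates are built from finite suprema, minima and
truncated differences, then divided by a sum that never vanishes. -/
theorem Tame.deform {Z : Type*} [TopologicalSpace Z] {g : Z → Y.Realization} (hg : Tame g)
    (hgB : ∀ z, (g z).InBall l (k + 1)) {θ : Z → NNReal} (hθ : Continuous θ) :
    Tame fun z => (g z).deform l k (θ z) := by
  obtain ⟨F, hF, hc⟩ := hg
  obtain ⟨F', hFF', hF'⟩ := exists_finset_push (k := k) hl hfin F
  have hpush : ∀ v, Continuous fun z => (g z).push l k (θ z) v := by
    have hsup : ∀ P : W → Prop, Continuous fun z => (g z).levelSup l k P := by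
      intro P
      simp only [fun z => (g z).levelSup_eq l k P (hF z)]
      exact Continuous.finset_sup_apply fun w _ => hc w
    intro v
    unfold push
    split_ifs
    · exact (hc v).sub hθ
    · exact (hc v).add ((hθ.min (hsup _)).sub (hsup _))
    · exact (hc v).add continuous_const
  refine ⟨F', fun z v hv => ?_, fun v => ?_⟩
  · exact hF' (g z) (hF z) (θ z) v (push_ne_zero_of_mem_support_deform hl hY hfin h4 (hgB z) hv)
  · have hs := fun z => deform_spec hl hY hfin h4 (hgB z) (θ z) (hF' (g z) (hF z) (θ z))
    simp only [fun z => (hs z).2 v]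
    exact (hpush v).div₀ (continuous_finsetSum _ fun a _ => hpush a) fun z => (hs z).1.ne'

omit hl hY hfin h4 in
variable (l) in
/-- The contraction of the ball of radius `n`: for `σ` between `1 / (k + 2)` and `1 / (k + 1)` the
ball of radius `k + 1` is deformed to the ball of radius `k`. -/
def contract : ℕ → Y.Realization → ℝ → Y.Realization
  | 0, x, _ => x
  | n + 1, x, σ =>
    if 1 / ((n : ℝ) + 1) ≤ σ then contract n (x.deform l n 1) σ
    -- The affine parameter runs from 0 at `1 / (n + 2)` to 1 at `1 / (n + 1)`; at earlier times it
    -- is truncated to 0.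
    else x.deform l n (Real.toNNReal ((((n : ℝ) + 2) * σ - 1) * (n + 1)))

theorem contract_of_le {n : ℕ} {x : Y.Realization} (hx : x.InBall l n) {σ : ℝ}
    (hσ : σ ≤ 1 / ((n : ℝ) + 1)) : x.contract l n σ = x := by
  cases n with
  | zero => rfl
  | succ n =>
    have hn : (0 : ℝ) < (n : ℝ) + 1 := by positivity
    have hlt : 1 / (((n + 1 : ℕ) : ℝ) + 1) < 1 / ((n : ℝ) + 1) := by
      refine one_div_lt_one_div_of_lt hn ?_
      push_cast
      linarith
    rw [contract, if_neg (not_le.2 (hσ.trans_lt hlt)), Real.toNNReal_of_nonpos]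
    · exact deform_zero hl hY hfin h4 hx
    · refine mul_nonpos_of_nonpos_of_nonneg ?_ hn.le
      rw [le_div_iff₀ (by positivity)] at hσ
      push_cast at hσ
      linarith

/-- The outer deformation fixes the smaller ball, so the contractions of all balls agree where they
overlap. -/
theorem contract_succ {n : ℕ} {x : Y.Realization} (hx : x.InBall l n) (σ : ℝ) :
    x.contract l (n + 1) σ = x.contract l n σ := by
  rw [contract]
  split_ifs with h
  · rw [deform_of_inBall hl hY hfin h4 hx]
  · rw [deform_of_inBall hl hY hfin h4 hx, contract_of_le hl hY hfin h4 hx (not_le.1 h).le]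

theorem contract_eq_of_le {m n : ℕ} (h : m ≤ n) {x : Y.Realization} (hx : x.InBall l m) (σ : ℝ) :
    x.contract l n σ = x.contract l m σ := by
  induction h with
  | refl => rfl
  | step h ih => rw [contract_succ hl hY hfin h4 (hx.mono h), ih]

theorem contract_one {n : ℕ} {x : Y.Realization} (hx : x.InBall l n) :
    x.contract l n 1 = vertex Y o := by
  induction n generalizing x with
  | zero =>
    rw [contract]
    exact eq_vertex fun v hv => Finset.mem_singleton.2 (hl.zero (Nat.le_zero.1 (hx v hv)))
  | succ n ih =>
    rw [contract, if_pos]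
    · exact ih (inBall_deform_one hl hY hfin h4 hx)
    · rw [div_le_one (by positivity)]
      linarith [(Nat.cast_nonneg n : (0 : ℝ) ≤ n)]

theorem Tame.contract {Z : Type*} [TopologicalSpace Z] {n : ℕ} {g : Z → Y.Realization}
    (hg : Tame g) (hgB : ∀ z, (g z).InBall l n) {θ : Z → ℝ} (hθ : Continuous θ) :
    Tame fun z => (g z).contract l n (θ z) := by
  induction n generalizing g with
  | zero => exact hg
  | succ n ih =>
    refine Tame.if_le (ih (hg.deform hl hY hfin h4 hgB continuous_const)
      (fun z => inBall_deform_one hl hY hfin h4 (hgB z))) (hg.deform hl hY hfin h4 hgB ?_) hθ ?_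
    · fun_prop
    · intro z hz
      have hn : ((n : ℝ) + 1) ≠ 0 := by positivity
      have h1 : (((n : ℝ) + 2) * (1 / ((n : ℝ) + 1)) - 1) * ((n : ℝ) + 1) = 1 := by
        field_simp
        ring
      -- At the junction the inner contraction has not started and the outer push is complete.
      rw [← hz, contract_of_le hl hY hfin h4 (inBall_deform_one hl hY hfin h4 (hgB z)) le_rfl, h1,
        Real.toNNReal_one]

end Realization

open Realization

/-- A flag complex with a level function and without four-wheels or infinite cliques is
contractible. -/
theorem contractibleSpace_of_isLevel {l : W → ℕ} {o : W} (hl : Y.oneSkeleton.IsLevel o l)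
    (hY : Y.IsFlag) (hfin : ∀ S : Set W, Y.oneSkeleton.IsClique S → S.Finite)
    (h4 : Y.oneSkeleton.NoFourWheel) : ContractibleSpace Y.Realization := by
  let N : Y.Realization → ℕ := fun x => x.coord.support.sup l
  have hN : ∀ x : Y.Realization, x.InBall l (N x) := fun x v hv => Finset.le_sup hv
  let K : Y.Realization → ℝ → Y.Realization := fun x σ => x.contract l (N x) σ
  -- Although `N` is not continuous, on a closed simplex it may be replaced by one constant.
  have hK : ∀ {n} {x : Y.Realization}, x.InBall l n → ∀ σ, K x σ = x.contract l n σ :=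
    fun {n x} hx σ => (contract_eq_of_le hl hY hfin h4 (Finset.sup_le hx) (hN x) σ).symm
  have hsimplex : ∀ s : Y.faces, Continuous fun p : stdSimplex ℝ (s : Finset W) × unitInterval =>
      K (Y.simplexInclusion s p.1) p.2 := by
    intro s
    have hB : ∀ x, (Y.simplexInclusion s x).InBall l ((s : Finset W).sup l) := fun x v hv =>
      Finset.le_sup (Y.support_simplexInclusion_subset s x hv)
    simp only [fun x => hK (hB x)]
    exact (((tame_simplexInclusion s).comp continuous_fst).contract hl hY hfin h4
      (fun p => hB p.1) (continuous_subtype_val.comp continuous_snd)).continuous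
  have hσ : ∀ x : Y.Realization, Continuous fun σ : unitInterval => K x σ := by
    intro x
    obtain ⟨p, hp⟩ := Y.exists_simplexInclusion_eq ⟨_, x.support_mem⟩ (x := x) subset_rfl
    have := (hsimplex ⟨_, x.support_mem⟩).comp (Continuous.prodMk_right p)
    rw [← hp]
    exact this
  -- Currying reduces joint continuity to single simplices, since the weak topology tests maps on
  -- simplices; the interval is locally compact, so one can uncurry.
  let C : Y.Realization → C(unitInterval, Y.Realization) := fun x => ⟨fun σ => K x σ, hσ x⟩
  have hC : Continuous C := continuous_realization_iff.2 fun s =>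
    ContinuousMap.continuous_of_continuous_uncurry _ (hsimplex s)
  have hF := ContinuousMap.continuous_uncurry_of_continuous ⟨C, hC⟩
  rw [contractible_iff_id_nullhomotopic]
  refine ⟨vertex Y o, ⟨⟨⟨fun p => K p.2 p.1, hF.comp continuous_swap⟩, fun x => ?_, fun x => ?_⟩⟩⟩
  · refine contract_of_le hl hY hfin h4 (hN x) ?_
    simp only [Set.Icc.coe_zero]
    positivity
  · exact contract_one hl hY hfin h4 (hN x)

end AbstractSimplicialComplex
-- Transport of level functions along bijective covers; level equals distance
namespace SimpleGraph

variable {V : Type u} {W : Type w} {H : SimpleGraph W} {G : SimpleGraph V} {p : W → V}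

theorem TriangleCover.finite_of_isClique (h : TriangleCover H G p)
    (hfin : ∀ S : Set V, G.IsClique S → S.Finite) (S : Set W) (hS : H.IsClique S) : S.Finite := by
  have hinj : Set.InjOn p S := fun a ha b hb hab =>
    by_contra fun hne => (h.hom (hS ha hb hne)).ne hab
  refine Set.Finite.of_finite_image (hfin (p '' S) ?_) hinj
  rintro _ ⟨a, ha, rfl⟩ _ ⟨b, hb, rfl⟩ hab
  exact h.hom (hS ha hb fun e => hab (congrArg p e))

theorem TriangleCover.surjective (h : TriangleCover H G p) (hG : G.Connected) [Nonempty W] :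
    Function.Surjective p := by
  intro v
  obtain ⟨a⟩ := (inferInstance : Nonempty W)
  obtain ⟨q⟩ := hG.preconnected v (p a)
  generalize hz : p a = z at q
  induction q with
  | nil => exact ⟨a, hz⟩
  | cons hadj _ ih =>
    obtain ⟨b, rfl⟩ := ih hz
    obtain ⟨c, -, hc⟩ := h.surj hadj.symm
    exact ⟨c, hc⟩

theorem TriangleCover.adj_iff (h : TriangleCover H G p) (hp : Function.Injective p) {a b : W} :
    G.Adj (p a) (p b) ↔ H.Adj a b := by
  refine ⟨fun hab => ?_, h.hom⟩
  obtain ⟨c, hc, hcb⟩ := h.surj hab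
  exact hp hcb ▸ hc

theorem TriangleCover.exists_isLevel (h : TriangleCover H G p) (hp : Function.Bijective p) {o : W}
    {l : W → ℕ} (hl : H.IsLevel o l) : ∃ l' : V → ℕ, G.IsLevel (p o) l' := by
  let e := Equiv.ofBijective p hp
  have he : ∀ a, e.symm (p a) = a := e.symm_apply_apply
  have hadj := fun a b => h.adj_iff hp.1 (a := a) (b := b)
  refine ⟨fun v => l (e.symm v), ⟨?_, ?_, ?_, ?_, ?_, ?_⟩⟩
  · rw [he, hl.base]
  · intro a ha
    obtain ⟨a, rfl⟩ := hp.2 a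
    rw [he] at ha
    rw [hl.zero ha]
  · intro a b hab
    obtain ⟨a, rfl⟩ := hp.2 a
    obtain ⟨b, rfl⟩ := hp.2 b
    rw [he, he]
    exact hl.step ((hadj a b).1 hab)
  · intro a k hk
    obtain ⟨a, rfl⟩ := hp.2 a
    rw [he] at hk
    obtain ⟨b, hb, hlb⟩ := hl.down hk
    exact ⟨p b, h.hom hb, by rw [he, hlb]⟩
  · intro a b c k ha hab hac hb hc
    obtain ⟨a, rfl⟩ := hp.2 a
    obtain ⟨b, rfl⟩ := hp.2 b
    obtain ⟨c, rfl⟩ := hp.2 c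
    rw [he] at ha hb hc
    exact h.near_map (hl.low ha ((hadj a b).1 hab) ((hadj a c).1 hac) hb hc)
  · intro a b k hab ha hb
    obtain ⟨a, rfl⟩ := hp.2 a
    obtain ⟨b, rfl⟩ := hp.2 b
    rw [he] at ha hb
    obtain ⟨c, hc, h1, h2⟩ := hl.edge ((hadj a b).1 hab) ha hb
    exact ⟨p c, by rw [he, hc], h.hom h1, h.hom h2⟩

theorem IsLevel.exists_walk {o : V} {l : V → ℕ} (hl : G.IsLevel o l) (n : ℕ) :
    ∀ a, l a = n → ∃ q : G.Walk a o, q.length = n := by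
  induction n with
  | zero => exact fun a ha => hl.zero ha ▸ ⟨Walk.nil, rfl⟩
  | succ n ih =>
    intro a ha
    obtain ⟨b, hab, hb⟩ := hl.down ha
    obtain ⟨q, hq⟩ := ih b hb
    exact ⟨Walk.cons hab q, by rw [Walk.length_cons, hq]⟩

/-- The axiom `down` provides a descending walk to the base point, and `step` prevents any shorter
one. -/
theorem IsLevel.edist_eq {o : V} {l : V → ℕ} (hl : G.IsLevel o l) (a : V) :
    G.edist o a = l a := by
  refine le_antisymm ?_ ?_
  · obtain ⟨q, hq⟩ := hl.exists_walk _ a rfl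
    rw [edist_comm, ← hq]
    exact q.edist_le
  · refine le_iInf fun q => ?_
    have : l a ≤ l o + q.length := by
      have hstep : ∀ {a b}, G.Adj a b → l b ≤ l a + 1 := hl.step
      clear * - q hstep
      induction q with
      | nil => exact Nat.le_add_right _ _
      | cons hadj q ih =>
        have := hstep hadj
        rw [Walk.length_cons]
        omega
    rw [hl.base, zero_add] at this
    exact_mod_cast this

end SimpleGraph

/-! ### The flag complex of a triangle cover and the conditions (E) and (V) -/

namespace AbstractSimplicialComplex

variable {V : Type u} {W : Type w}

/-- The flag complex of a graph. -/
def flagComplex (H : SimpleGraph W) : AbstractSimplicialComplex W where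
  faces := {s | s.Nonempty ∧ ∀ a ∈ s, ∀ b ∈ s, H.Near a b}
  isRelLowerSet_faces := fun _ hs =>
    ⟨hs.1, fun _ hts ht => ⟨ht, fun a ha b hb => hs.2 a (hts ha) b (hts hb)⟩⟩
  singleton_mem := fun v => ⟨Finset.singleton_nonempty v, fun _ ha _ hb =>
    Or.inl ((Finset.mem_singleton.1 ha).trans (Finset.mem_singleton.1 hb).symm)⟩

theorem oneSkeleton_flagComplex (H : SimpleGraph W) : (flagComplex H).oneSkeleton = H := by
  ext a b
  constructor
  · rintro ⟨hne, -, h⟩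
    exact (h a (by simp) b (by simp)).resolve_left hne
  · intro h
    refine ⟨h.ne, ⟨a, by simp⟩, fun c hc d hd => ?_⟩
    simp only [Finset.mem_insert, Finset.mem_singleton] at hc hd
    rcases hc with rfl | rfl <;> rcases hd with rfl | rfl
    · exact Or.inl rfl
    · exact Or.inr h
    · exact Or.inr h.symm
    · exact Or.inl rfl

theorem isFlag_flagComplex (H : SimpleGraph W) : (flagComplex H).IsFlag := by
  intro s hs hcl
  rw [oneSkeleton_flagComplex] at hcl
  exact ⟨hs, fun a ha b hb => or_iff_not_imp_left.2 fun hab => hcl ha hb hab⟩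

/-- A triangle cover of the `1`-skeleton of a flag complex as a simplicial map. -/
def coverMap {H : SimpleGraph W} {X : AbstractSimplicialComplex V} (hX : X.IsFlag) {p : W → V}
    (h : H.TriangleCover X.oneSkeleton p) : SimplicialMap (flagComplex H) X where
  toFun := p
  map_faces := fun s hs => hX.mem_of_near (hs.1.image p) fun u hu v hv => by
    obtain ⟨a, ha, rfl⟩ := Finset.mem_image.1 hu
    obtain ⟨b, hb, rfl⟩ := Finset.mem_image.1 hv
    exact h.near_map (hs.2 a ha b hb)

theorem isCoveringMap_coverMap {X : AbstractSimplicialComplex V} (hX : X.IsFlag)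
    {H : SimpleGraph W} {p : W → V} (h : H.TriangleCover X.oneSkeleton p) :
    IsCoveringMap (coverMap hX h).realize := by
  refine isCoveringMap_realize ?_ (isFlag_flagComplex H)
  rw [oneSkeleton_flagComplex]
  exact h

section cover

variable {X : AbstractSimplicialComplex V}
  (hfin : ∀ S : Set V, X.oneSkeleton.IsClique S → S.Finite) (h4 : X.oneSkeleton.NoFourWheel)
include hfin h4

theorem contractibleSpace_flagComplex {H : SimpleGraph W} {p : W → V}
    (h : H.TriangleCover X.oneSkeleton p) {o : W} {l : W → ℕ} (hl : H.IsLevel o l) :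
    ContractibleSpace (flagComplex H).Realization := by
  have e := oneSkeleton_flagComplex H
  refine contractibleSpace_of_isLevel (l := l) (o := o) ?_ (isFlag_flagComplex H) ?_ ?_
  · rwa [e]
  · rw [e]
    exact h.finite_of_isClique hfin
  · rw [e]
    exact h.noFourWheel h4

/-- In a simply connected complex the distance from every vertex is a level function. -/
theorem exists_isLevel_of_simplyConnected (hX : X.IsFlag) (h5 : X.oneSkeleton.FiveWheelCone)
    [SimplyConnectedSpace X.Realization] (v : V) : ∃ l, X.oneSkeleton.IsLevel v l := by
  obtain ⟨W, H, p, o, l, rfl, h, hl⟩ := X.oneSkeleton.exists_triangleCover h4 h5 v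
  have := contractibleSpace_flagComplex hfin h4 h hl
  have : Nonempty W := ⟨o⟩
  -- The contractible source is path connected, so simple connectedness of `X` makes the covering
  -- injective on vertices and the level function descends.
  exact h.exists_isLevel ⟨injective_of_isCoveringMap (isCoveringMap_coverMap hX h),
    h.surjective connected_oneSkeleton⟩ hl

end cover

theorem satisfiesWeakSD_of_isLevel {X : AbstractSimplicialComplex V} (hX : X.IsFlag)
    (hfin : ∀ S : Set V, X.oneSkeleton.IsClique S → S.Finite) {v : V} {l : V → ℕ}
    (hl : X.oneSkeleton.IsLevel v l) (n : ℕ) : X.SatisfiesWeakSD n v := by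
  have hball : ∀ {i : ℕ} {s : Finset V},
      s ∈ (X.ball v i).faces ↔ s ∈ X.faces ∧ ∀ a ∈ s, l a ≤ i := by
    intro i s
    refine and_congr_right fun _ => forall₂_congr fun a _ => ?_
    rw [Set.mem_ofPred_eq, hl.edist_eq, Nat.cast_le]
  have hsphere : ∀ {i : ℕ} {s : Finset V},
      s ∈ (X.sphere v i).faces ↔ s ∈ X.faces ∧ ∀ a ∈ s, l a = i := by
    intro i s
    refine and_congr_right fun _ => forall₂_congr fun a _ => ?_
    rw [Set.mem_ofPred_eq, hl.edist_eq, Nat.cast_inj]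
  intro i _ _
  constructor
  · intro e he hcard
    obtain ⟨a, b, hab, rfl⟩ := Finset.card_eq_two.1 hcard
    obtain ⟨hface, hlev⟩ := hsphere.1 he
    have hla := hlev a (by simp)
    have hlb := hlev b (by simp)
    obtain ⟨c, hc, hac, hbc⟩ := hl.edge (adj_of_mem_face hface (by simp) (by simp) hab) hla hlb
    refine ⟨{c}, ⟨X.singleton_mem c, ?_, ?_⟩, hball.2 ⟨X.singleton_mem c, by simp [hc]⟩⟩
    · rw [Finset.disjoint_singleton_left]
      simp only [Finset.mem_insert, Finset.mem_singleton]
      rintro (rfl | rfl) <;> omega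
    · refine hX.mem_of_near ⟨c, by simp⟩ fun x hx y hy => ?_
      simp only [Finset.mem_union, Finset.mem_insert, Finset.mem_singleton] at hx hy
      have hab' := adj_of_mem_face hface (by simp) (by simp) hab
      rcases hx with rfl | rfl | rfl <;> rcases hy with rfl | rfl | rfl <;>
      first
      | exact Or.inl rfl
      | exact Or.inr (by assumption)
      | exact Or.inr (SimpleGraph.Adj.symm (by assumption))
  · intro w hw
    have hlw : l w = i + 1 := (hsphere.1 hw).2 w (by simp)
    -- The simplex of condition (V) consists of all lower neighbours of `w`.
    have hτ := hl.finite_lower hfin hlw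
    have hmem : ∀ {a}, a ∈ hτ.toFinset ↔ l a = i ∧ X.oneSkeleton.Adj w a := hτ.mem_toFinset
    obtain ⟨b, hb, hlb⟩ := hl.down hlw
    have hτface : hτ.toFinset ∈ X.faces := hX.mem_of_near ⟨b, hmem.2 ⟨hlb, hb⟩⟩
      fun x hx y hy => hl.low hlw (hmem.1 hx).2 (hmem.1 hy).2 (hmem.1 hx).1 (hmem.1 hy).1
    refine ⟨_, hτface, Set.ext fun ρ => ⟨?_, ?_⟩⟩
    · rintro ⟨⟨hρ, hdisj, hun⟩, hρB⟩
      refine ⟨(X.isRelLowerSet_faces hρ).1, fun a ha => ?_⟩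
      have hne : w ≠ a := by
        rintro rfl
        exact Finset.disjoint_left.1 hdisj ha (Finset.mem_singleton_self _)
      have hadj := adj_of_mem_face hun (Finset.mem_union_right _ (Finset.mem_singleton_self w))
        (Finset.mem_union_left _ ha) hne
      have h1 := (hball.1 hρB).2 a ha
      have h2 := hl.step hadj.symm
      exact hmem.2 ⟨by omega, hadj⟩
    · rintro ⟨hne, hsub⟩
      have hρ := (X.isRelLowerSet_faces hτface).2 hsub hne
      refine ⟨⟨hρ, ?_, ?_⟩, hball.2 ⟨hρ, fun a ha => (hmem.1 (hsub ha)).1.le⟩⟩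
      · rw [Finset.disjoint_singleton_right]
        intro hw
        exact (hmem.1 (hsub hw)).2.ne rfl
      · refine hX.mem_of_near (hne.mono Finset.subset_union_left) fun x hx y hy => ?_
        rcases Finset.mem_union.1 hx with hx | hx <;> rcases Finset.mem_union.1 hy with hy | hy
        · exact near_of_mem_face hρ hx hy
        · rw [Finset.mem_singleton.1 hy]
          exact Or.inr (hmem.1 (hsub hx)).2.symm
        · rw [Finset.mem_singleton.1 hx]
          exact Or.inr (hmem.1 (hsub hy)).2
        · exact Or.inl ((Finset.mem_singleton.1 hx).trans (Finset.mem_singleton.1 hy).symm)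

/-- An induced subgraph on `Fin k` given by its vertices. -/
def _root_.SimpleGraph.embeddingOfLt {G : SimpleGraph V} {k : ℕ} (H : SimpleGraph (Fin k))
    (r : Fin k → V) (h : ∀ i j, i < j → r i ≠ r j ∧ (G.Adj (r i) (r j) ↔ H.Adj i j)) : H ↪g G where
  toFun := r
  inj' := fun i j hij => by
    rcases lt_trichotomy i j with hlt | rfl | hlt
    · exact absurd hij (h i j hlt).1
    · rfl
    · exact absurd hij.symm (h j i hlt).1
  map_rel_iff' := fun {i j} => by
    change G.Adj (r i) (r j) ↔ H.Adj i j
    rcases lt_trichotomy i j with hlt | rfl | hlt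
    · exact (h i j hlt).2
    · exact iff_of_false (SimpleGraph.irrefl _) (SimpleGraph.irrefl _)
    · rw [G.adj_comm, H.adj_comm]
      exact (h j i hlt).2

/-! ### From wheels given by induced cycles to conditions on the graph -/

section wheels

variable {X : AbstractSimplicialComplex V} (h : X.SatisfiesSD2Star)
include h

theorem SatisfiesSD2Star.noFourWheel : X.oneSkeleton.NoFourWheel := by
  intro c x₀ x₁ x₂ x₃ h0 h1 h2 h3 h01 h12 h23 h30
  by_contra! hne
  obtain ⟨n02, n13⟩ := hne
  simp only [SimpleGraph.Near, not_or] at n02 n13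
  refine h.2.1 ⟨c, SimpleGraph.embeddingOfLt _ ![x₀, x₁, x₂, x₃] ?_, ?_⟩
  · have adj : ∀ {a b : V} {i j : Fin 4}, X.oneSkeleton.Adj a b → (i - j = 1 ∨ j - i = 1) →
        a ≠ b ∧ (X.oneSkeleton.Adj a b ↔ (SimpleGraph.cycleGraph 4).Adj i j) :=
      fun hab hij => ⟨hab.ne, iff_of_true hab (SimpleGraph.cycleGraph_adj.2 hij)⟩
    have far : ∀ {a b : V} {i j : Fin 4}, (a ≠ b ∧ ¬ X.oneSkeleton.Adj a b) →
        ¬ (i - j = 1 ∨ j - i = 1) →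
        a ≠ b ∧ (X.oneSkeleton.Adj a b ↔ (SimpleGraph.cycleGraph 4).Adj i j) :=
      fun hab hij => ⟨hab.1, iff_of_false hab.2 (mt SimpleGraph.cycleGraph_adj.1 hij)⟩
    intro i j hij
    fin_cases i <;> fin_cases j <;>
    first
    | exact absurd hij (by decide)
    | exact adj h01 (by decide)
    | exact adj h12 (by decide)
    | exact adj h23 (by decide)
    | exact adj h30.symm (by decide)
    | exact far n02 (by decide)
    | exact far n13 (by decide)
  · intro i
    fin_cases i
    exacts [h0, h1, h2, h3]

theorem SatisfiesSD2Star.fiveWheelCone : X.oneSkeleton.FiveWheelCone := by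
  intro c x₀ x₁ x₂ x₃ x₄ t h0 h1 h2 h3 h4 h01 h12 h23 h34 h40 n02 n03 n13 n14 n24 ht0 ht1 htc ht2
    ht3 ht4
  simp only [SimpleGraph.Near, not_or] at n02 n03 n13 n14 n24
  have adj : ∀ {a b : V} {i j : Fin 5}, X.oneSkeleton.Adj a b → (i - j = 1 ∨ j - i = 1) →
      a ≠ b ∧ (X.oneSkeleton.Adj a b ↔ (SimpleGraph.cycleGraph 5).Adj i j) :=
    fun hab hij => ⟨hab.ne, iff_of_true hab (SimpleGraph.cycleGraph_adj.2 hij)⟩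
  have far : ∀ {a b : V} {i j : Fin 5}, (a ≠ b ∧ ¬ X.oneSkeleton.Adj a b) →
      ¬ (i - j = 1 ∨ j - i = 1) →
      a ≠ b ∧ (X.oneSkeleton.Adj a b ↔ (SimpleGraph.cycleGraph 5).Adj i j) :=
    fun hab hij => ⟨hab.1, iff_of_false hab.2 (mt SimpleGraph.cycleGraph_adj.1 hij)⟩
  let r : SimpleGraph.cycleGraph 5 ↪g X.oneSkeleton :=
    SimpleGraph.embeddingOfLt _ ![x₀, x₁, x₂, x₃, x₄] (by
      intro i j hij
      fin_cases i <;> fin_cases j <;>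
      first
      | exact absurd hij (by decide)
      | exact adj h01 (by decide)
      | exact adj h12 (by decide)
      | exact adj h23 (by decide)
      | exact adj h34 (by decide)
      | exact adj h40.symm (by decide)
      | exact far n02 (by decide)
      | exact far n03 (by decide)
      | exact far n13 (by decide)
      | exact far n14 (by decide)
      | exact far n24 (by decide))
  obtain ⟨v, hc, hr, ht⟩ := h.2.2 c r t (by
      intro i
      fin_cases i
      exacts [h0, h1, h2, h3, h4])
    (by
      refine h.1.mem_of_near ⟨t, by simp⟩ fun a ha b hb => ?_
      change a ∈ ({x₀, x₁, t} : Finset V) at ha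
      change b ∈ ({x₀, x₁, t} : Finset V) at hb
      simp only [Finset.mem_insert, Finset.mem_singleton] at ha hb
      rcases ha with rfl | rfl | rfl <;> rcases hb with rfl | rfl | rfl <;>
      first
      | exact Or.inl rfl
      | exact Or.inr (by assumption)
      | exact Or.inr (SimpleGraph.Adj.symm (by assumption)))
    htc (by
      intro i
      fin_cases i
      exacts [ht0.ne, ht1.ne, ht2, ht3, ht4])
  have hnear : ∀ {a}, {a} ∈ (X.ball v 1).faces → X.oneSkeleton.Near v a := by
    intro a ha
    have h1 : X.oneSkeleton.edist v a ≤ 1 := by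
      have := ha.2 (Finset.mem_coe.2 (Finset.mem_singleton_self a))
      simpa using this
    exact SimpleGraph.edist_le_one_iff_adj_or_eq.1 h1 |>.symm
  exact ⟨v, hnear hc, hnear (hr 0), hnear (hr 1), hnear (hr 2), hnear (hr 3), hnear (hr 4),
    hnear ht⟩

end wheels

end AbstractSimplicialComplex
end

/-! ### Existence and properties of universal covers -/

theorem theoremB {V : Type u} (X : AbstractSimplicialComplex V)
    (hconn : X.oneSkeleton.Connected)
    (hclique : ∀ S : Set V, X.oneSkeleton.IsClique S → S.Finite)
    (hX : X.SatisfiesSD2Star) :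
    (∃ (V' : Type u) (Y : AbstractSimplicialComplex V')
      (f : AbstractSimplicialComplex.SimplicialMap Y X),
      AbstractSimplicialComplex.IsUniversalCover f) ∧
    ∀ (V' : Type w) (Y : AbstractSimplicialComplex V')
      (f : AbstractSimplicialComplex.SimplicialMap Y X),
      AbstractSimplicialComplex.IsUniversalCover f →
        Y.IsWeaklySystolic ∧ ContractibleSpace Y.Realization := by
  have h4 := hX.noFourWheel
  have h5 := hX.fiveWheelCone
  constructor
  · obtain ⟨o⟩ := hconn.nonempty
    obtain ⟨W, H, p, o', l, -, h, hl⟩ := X.oneSkeleton.exists_triangleCover h4 h5 o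
    have := AbstractSimplicialComplex.contractibleSpace_flagComplex hclique h4 h hl
    exact ⟨W, _, AbstractSimplicialComplex.coverMap hX.1 h,
      AbstractSimplicialComplex.isCoveringMap_coverMap hX.1 h, inferInstance⟩
  · rintro W Y f ⟨hf, hsc⟩
    have hc := AbstractSimplicialComplex.triangleCover_of_isCoveringMap hf hX.1
    have hY := AbstractSimplicialComplex.isFlag_of_isCoveringMap hf hX.1
    have hfin := hc.finite_of_isClique hclique
    -- The construction is applied to `Y` itself, which inherits flagness, the wheel conditions and
    -- finiteness of cliques.
    have hlevel := AbstractSimplicialComplex.exists_isLevel_of_simplyConnected hfin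
      (hc.noFourWheel h4) hY (hc.fiveWheelCone h5)
    refine ⟨⟨hY, fun n v => ?_⟩, ?_⟩
    · obtain ⟨l, hl⟩ := hlevel v
      exact AbstractSimplicialComplex.satisfiesWeakSD_of_isLevel hY hfin hl n
    · obtain ⟨v⟩ := (AbstractSimplicialComplex.connected_oneSkeleton (Y := Y)).nonempty
      obtain ⟨l, hl⟩ := hlevel v
      exact AbstractSimplicialComplex.contractibleSpace_of_isLevel hl hY hfin (hc.noFourWheel h4)
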